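/- Let $k$ be a field of characteristic different from $2$, let $d\ge 6$ be even, and put $g=\frac{d-2}{2}$. Let $\mathbf X_d$ be the affine space of binary forms $F(x,z)$ of degree $d$ over $k$, and $\mathbf X_d^0=\{F:\operatorname{Disc}(F)\ne 0\}$. Let $G=\mathrm{GL}_2$ act on forms by $(u\cdot F)(x,z)=F(u^{-1}(x,z))$. Let $$\pi\colon \mathbf Y_d^0=\{(F,(x:y:z))\in \mathbf X_d^0\times\mathbb P(1,\tfrac d2,1) : y^2=F(x,z)\}\longrightarrow \mathbf X_d^0$$ be the universal hyperelliptic curve, with fibre $C_F$ over $F$, and let $\boldsymbol\alpha=\bigwedge^g\pi_*\Omega^1_{\mathbf Y_d^0/\mathbf X_d^0}$ be its Hodge bundle. For $u\in G$ let $\phi_u\colon C_F\to C_{u\cdot F}$ be the isomorphism sending $(x,y,z)$ to $(x',y,z')$, where $(x',z')=u(x,z)$. For a section $s$ of $\boldsymbol\alpha^{\otimes h}$ let $\phi_u^*s$ be the section with $(\phi_u^*s)(F)=\phi_u^*\big(s(u\cdot F)\big)$. There are unique sections $\omega_1,\dots,\omega_g$ of $\pi_*\Omega^1_{\mathbf Y_d^0/\mathbf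 X_d^0}$ with $y\,\omega_i=x^{i-1}dx$ on the chart $z=1$, that is, $\omega_i=x^{i-1}dx/y$. Put $\omega=\omega_1\wedge\dots\wedge\omega_g\in\Gamma(\mathbf X_d^0,\boldsymbol\alpha)$. 1. The number $\frac{dg}{4}$ is an integer, and for all $u\in G$, $$\phi_u^*\omega=\det(u)^{dg/4}\,\omega .$$ 2. Let $h\ge 0$ be an integer. For an integer $w\ge 0$ let $\operatorname{Inv}_w(\mathbf X_d^0)$ be the $k$-space of regular functions $\Phi$ on $\mathbf X_d^0$ with $\Phi(\lambda F)=\lambda^w\Phi(F)$ for all nonzero scalars $\lambda$ and $\Phi(u\cdot F)=\Phi(F)$ for all $u\in\mathrm{SL}_2$. Let $\Gamma(\mathbf X_d^0,\boldsymbol\alpha^{\otimes h})^G$ be the $k$-space of sections $s$ of $\boldsymbol\alpha^{\otimes h}$ with $\phi_u^*s=s$ for all $u\in G$. If $gh$ is even, then $$\tau\colon \operatorname{Inv}_{gh/2}(\mathbf X_d^0)\to\Gamma(\mathbf X_d^0,\boldsymbol\alpha^{\otimes h})^G,\qquad \Phi\mapsto\Phi\cdot\omega^{\otimes h}$$ is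 a well-defined isomorphism of $k$-vector spaces. If $gh$ is odd, then $\Gamma(\mathbf X_d^0,\boldsymbol\alpha^{\otimes h})^G=0$ (there are no nonzero invariants of half-integral degree, so the statement holds with $\operatorname{Inv}_{gh/2}(\mathbf X_d^0)=0$). Here $\mathbf X_d^0$ and $G$ are understood as a variety and an algebraic group: the conditions and identities indexed by $F$, $\lambda$, $u$ refer to points over all extension fields $K$ of $k$ (over an infinite field $k$ this is equivalent to using the $k$-points of $G$ and the scalars in $k^\times$). -/

import Mathlib

open Polynomial TensorProduct

universe u
namespace HyperellipticHodge
noncomputable section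

/-! ## Pulling back Kähler differentials -/

section Kaehler
variable {R S A B : Type*} [CommRing R] [CommRing S] [CommRing A] [CommRing B]
  [Algebra R A] [Algebra S B]

/-- The map `a db ↦ φ(a) d(φ b)` on relative differentials induced by a commutative square of
ring homomorphisms `f : R → S`, `φ : A → B`. -/
def kaehlerMap (f : R →+* S) (φ : A →+* B)
    (h : ∀ r, φ (algebraMap R A r) = algebraMap S B (f r)) : Ω[A⁄R] →ₛₗ[φ] Ω[B⁄S] :=
  letI : Algebra R S := f.toAlgebra
  letI : Algebra A B := φ.toAlgebra
  letI : Algebra R B := (φ.comp (algebraMap R A)).toAlgebra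
  haveI : IsScalarTower R A B := IsScalarTower.of_algebraMap_eq fun _ => rfl
  haveI : IsScalarTower R S B := IsScalarTower.of_algebraMap_eq fun r => h r
  { toFun := KaehlerDifferential.map R S A B
    map_add' := map_add _
    map_smul' := fun a m => (KaehlerDifferential.map R S A B).map_smul a m }

theorem kaehlerMap_D (f : R →+* S) (φ : A →+* B)
    (h : ∀ r, φ (algebraMap R A r) = algebraMap S B (f r)) (a : A) :
    kaehlerMap f φ h (KaehlerDifferential.D R A a) = KaehlerDifferential.D S B (φ a) := by
  let _ : Algebra R S := f.toAlgebra
  let _ : Algebra A B := φ.toAlgebra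
  let _ : Algebra R B := (φ.comp (algebraMap R A)).toAlgebra
  have : IsScalarTower R A B := IsScalarTower.of_algebraMap_eq fun _ => rfl
  have : IsScalarTower R S B := IsScalarTower.of_algebraMap_eq fun r => h r
  exact KaehlerDifferential.map_D R S A B a

theorem kaehler_induction {P : Ω[A⁄R] → Prop} (h0 : P 0) (hadd : ∀ m n, P m → P n → P (m + n))
    (hD : ∀ a b : A, P (a • KaehlerDifferential.D R A b)) (m : Ω[A⁄R]) : P m := by
  have hm : m ∈ Submodule.span A (Set.range (KaehlerDifferential.D R A)) := by
    rw [KaehlerDifferential.span_range_derivation]; trivial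
  induction hm using Submodule.closure_induction with
  | zero => exact h0
  | add x y _ _ hx hy => exact hadd x y hx hy
  | smul_mem r x h => obtain ⟨b, rfl⟩ := h; exact hD r b

theorem kaehlerMap_comp {T C : Type*} [CommRing T] [CommRing C] [Algebra T C]
    (f : R →+* S) (φ : A →+* B) (h : ∀ r, φ (algebraMap R A r) = algebraMap S B (f r))
    (f' : S →+* T) (φ' : B →+* C) (h' : ∀ s, φ' (algebraMap S B s) = algebraMap T C (f' s))
    (f'' : R →+* T) (φ'' : A →+* C) (h'' : ∀ r, φ'' (algebraMap R A r) = algebraMap T C (f'' r))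
    (e : ∀ a, φ'' a = φ' (φ a)) (m : Ω[A⁄R]) :
    kaehlerMap f' φ' h' (kaehlerMap f φ h m) = kaehlerMap f'' φ'' h'' m := by
  induction m using kaehler_induction with
  | h0 => simp
  | hadd m n hm hn => simp only [map_add, hm, hn]
  | hD a b => simp only [map_smulₛₗ, kaehlerMap_D, e]

end Kaehler

section Pull
variable {R A B C : Type*} [CommRing R] [CommRing A] [CommRing B] [CommRing C]
  [Algebra R A] [Algebra R B] [Algebra R C]

/-- The pullback of relative differential forms along a morphism of affine `R`-schemes
`Spec B → Spec A`, given by an `R`-algebra homomorphism `A → B`. -/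
def pull (φ : A →ₐ[R] B) : Ω[A⁄R] →ₗ[R] Ω[B⁄R] :=
  { toFun := kaehlerMap (RingHom.id R) φ.toRingHom (fun r => φ.commutes r)
    map_add' := map_add _
    map_smul' := fun r m => by
      rw [← algebraMap_smul A r m, map_smulₛₗ]
      change φ (algebraMap R A r) • _ = _
      rw [φ.commutes, algebraMap_smul, RingHom.id_apply] }

theorem pull_D (φ : A →ₐ[R] B) (a : A) :
    pull φ (KaehlerDifferential.D R A a) = KaehlerDifferential.D R B (φ a) :=
  kaehlerMap_D (RingHom.id R) φ.toRingHom (fun r => φ.commutes r) a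

theorem pull_smul (φ : A →ₐ[R] B) (a : A) (m : Ω[A⁄R]) : pull φ (a • m) = φ a • pull φ m :=
  map_smulₛₗ (kaehlerMap (RingHom.id R) φ.toRingHom (fun r => φ.commutes r)) a m

theorem pull_pull (ψ : B →ₐ[R] C) (φ : A →ₐ[R] B) (χ : A →ₐ[R] C) (e : ∀ a, χ a = ψ (φ a))
    (m : Ω[A⁄R]) : pull ψ (pull φ m) = pull χ m :=
  kaehlerMap_comp (RingHom.id R) φ.toRingHom (fun r => φ.commutes r) (RingHom.id R) ψ.toRingHom
    (fun r => ψ.commutes r) (RingHom.id R) χ.toRingHom (fun r => χ.commutes r) e m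

theorem pull_toAlgHom [Algebra A B] [IsScalarTower R A B] (m : Ω[A⁄R]) :
    pull (IsScalarTower.toAlgHom R A B) m = KaehlerDifferential.map R R A B m := by
  induction m using kaehler_induction with
  | h0 => simp
  | hadd m n hm hn => simp only [map_add, hm, hn]
  | hD a b => simp [pull_smul, pull_D]

end Pull

/-! ## Gluing two local sections of a module -/

theorem glue_sep {T M M₁ M₂ : Type*} [CommRing T] [AddCommGroup M] [Module T M]
    [AddCommGroup M₁] [Module T M₁] [AddCommGroup M₂] [Module T M₂] {x z : T} (hxz : IsCoprime x z)
    (l₁ : M →ₗ[T] M₁) [IsLocalizedModule (Submonoid.powers z) l₁]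
    (l₂ : M →ₗ[T] M₂) [IsLocalizedModule (Submonoid.powers x) l₂] {m n : M}
    (h₁ : l₁ m = l₁ n) (h₂ : l₂ m = l₂ n) : m = n := by
  obtain ⟨⟨_, i, rfl⟩, hi⟩ := (IsLocalizedModule.eq_iff_exists (Submonoid.powers z) l₁).1 h₁
  obtain ⟨⟨_, j, rfl⟩, hj⟩ := (IsLocalizedModule.eq_iff_exists (Submonoid.powers x) l₂).1 h₂
  obtain ⟨a, b, hab⟩ := hxz.pow (m := j) (n := i)
  change z ^ i • m = z ^ i • n at hi
  change x ^ j • m = x ^ j • n at hj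
  rw [← one_smul T m, ← one_smul T n, ← hab, add_smul, add_smul, mul_smul, mul_smul, mul_smul,
    mul_smul, hi, hj]

theorem glue_exists {T M M₁ M₂ M₁₂ : Type*} [CommRing T] [AddCommGroup M] [Module T M]
    [AddCommGroup M₁] [Module T M₁] [AddCommGroup M₂] [Module T M₂] [AddCommGroup M₁₂]
    [Module T M₁₂] {x z : T} (hxz : IsCoprime x z)
    (l₁ : M →ₗ[T] M₁) [IsLocalizedModule (Submonoid.powers z) l₁]
    (l₂ : M →ₗ[T] M₂) [IsLocalizedModule (Submonoid.powers x) l₂]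
    (l₁₂ : M →ₗ[T] M₁₂) [IsLocalizedModule (Submonoid.powers (z * x)) l₁₂]
    (r₁ : M₁ →ₗ[T] M₁₂) (r₂ : M₂ →ₗ[T] M₁₂) (e₁ : ∀ m, r₁ (l₁ m) = l₁₂ m)
    (e₂ : ∀ m, r₂ (l₂ m) = l₁₂ m) (m₁ : M₁) (m₂ : M₂) (h : r₁ m₁ = r₂ m₂) :
    ∃ m, l₁ m = m₁ ∧ l₂ m = m₂ := by
  obtain ⟨⟨n₁, _, k, rfl⟩, h₁⟩ := IsLocalizedModule.surj (Submonoid.powers z) l₁ m₁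
  obtain ⟨⟨n₂, _, j, rfl⟩, h₂⟩ := IsLocalizedModule.surj (Submonoid.powers x) l₂ m₂
  change z ^ k • m₁ = l₁ n₁ at h₁
  change x ^ j • m₂ = l₂ n₂ at h₂
  have h₃ : l₁₂ (x ^ j • n₁) = l₁₂ (z ^ k • n₂) := by
    rw [map_smul, map_smul, ← e₁, ← e₂, ← h₁, ← h₂, map_smul, map_smul, h, smul_comm]
  obtain ⟨⟨_, c, rfl⟩, hc⟩ :=
    (IsLocalizedModule.eq_iff_exists (Submonoid.powers (z * x)) l₁₂).1 h₃
  change (z * x) ^ c • x ^ j • n₁ = (z * x) ^ c • z ^ k • n₂ at hc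
  obtain ⟨b, a, hab⟩ := hxz.pow (m := j + c) (n := k + c)
  refine ⟨a • z ^ c • n₁ + b • x ^ c • n₂, ?_, ?_⟩
  · apply IsLocalizedModule.smul_injective l₁ (⟨z ^ (k + c), k + c, rfl⟩ : Submonoid.powers z)
    change z ^ (k + c) • l₁ _ = z ^ (k + c) • m₁
    have e : z ^ (k + c) • (a • z ^ c • n₁ + b • x ^ c • n₂) = z ^ c • n₁ := by
      calc _ = (a * z ^ (k + c)) • z ^ c • n₁ + b • (z * x) ^ c • z ^ k • n₂ := by module
        _ = (b * x ^ (j + c) + a * z ^ (k + c)) • z ^ c • n₁ := by rw [← hc]; module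
        _ = _ := by rw [hab, one_smul]
    rw [← map_smul, e, map_smul, ← h₁]; module
  · apply IsLocalizedModule.smul_injective l₂ (⟨x ^ (j + c), j + c, rfl⟩ : Submonoid.powers x)
    change x ^ (j + c) • l₂ _ = x ^ (j + c) • m₂
    have e : x ^ (j + c) • (a • z ^ c • n₁ + b • x ^ c • n₂) = x ^ c • n₂ := by
      calc _ = a • (z * x) ^ c • x ^ j • n₁ + (b * x ^ (j + c)) • x ^ c • n₂ := by module
        _ = (b * x ^ (j + c) + a * z ^ (k + c)) • x ^ c • n₂ := by rw [hc]; module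
        _ = _ := by rw [hab, one_smul]
    rw [← map_smul, e, map_smul, ← h₂]; module

/-! ## Binary forms -/

section Forms

/-- Binary forms `F(x, z) = ∑ aᵢ xⁱ z^(d - i)` of degree `d` with coefficients in `R`, given by
their coefficients `a₀, …, a_d`. -/
abbrev BinaryForm (R : Type*) (d : ℕ) := Fin (d + 1) → R

variable {R T : Type*} [CommRing R] [CommRing T] [Algebra R T] {d : ℕ}

/-- The value `F(x, z) = ∑ aᵢ xⁱ z^(d - i)`. -/
def BinaryForm.eval (F : BinaryForm R d) (x z : T) : T :=
  ∑ i, algebraMap R T (F i) * x ^ (i : ℕ) * z ^ (d - i)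

/-- The form `F(z, x)`. -/
def BinaryForm.rev (F : BinaryForm R d) : BinaryForm R d := fun i => F (Fin.rev i)

theorem BinaryForm.eval_rev (F : BinaryForm R d) (x z : T) : F.rev.eval x z = F.eval z x := by
  unfold BinaryForm.eval BinaryForm.rev
  rw [← Equiv.sum_comp Fin.revPerm]
  refine Finset.sum_congr rfl fun i _ => ?_
  have h1 : ((Fin.rev i : Fin (d + 1)) : ℕ) = d - i := by rw [Fin.val_rev]; omega
  have h2 : d - (d - (i : ℕ)) = i := by have := i.2; omega
  simp only [Fin.revPerm_apply, Fin.rev_rev, h1, h2]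
  ring

theorem BinaryForm.eval_mul (F : BinaryForm R d) (c x z : T) :
    F.eval (c * x) (c * z) = c ^ d * F.eval x z := by
  unfold BinaryForm.eval
  rw [Finset.mul_sum]
  refine Finset.sum_congr rfl fun i _ => ?_
  have h : c ^ d = c ^ (i : ℕ) * c ^ (d - i) := by
    rw [← pow_add]; congr 1; have := i.2; omega
  rw [h]; ring

theorem BinaryForm.map_eval {T' : Type*} [CommRing T'] [Algebra R T'] (ψ : T →ₐ[R] T')
    (F : BinaryForm R d) (x z : T) : ψ (F.eval x z) = F.eval (ψ x) (ψ z) := by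
  simp [BinaryForm.eval]

/-- The discriminant of binary forms of degree `d`, an integral polynomial in the coefficients
`a₀, …, a_d`. -/
def discPoly (d : ℕ) : MvPolynomial (Fin (d + 1)) ℤ :=
  (∑ i : Fin (d + 1), C (MvPolynomial.X i) * X ^ (i : ℕ) :
    (MvPolynomial (Fin (d + 1)) ℤ)[X]).discr

/-- The discriminant `Disc(F)` of a binary form. -/
def BinaryForm.disc (F : BinaryForm R d) : R := MvPolynomial.aeval F (discPoly d)

/-- The form `(u · F)(x, z) = F(u⁻¹(x, z))`. -/
def BinaryForm.act (u : GL (Fin 2) R) (F : BinaryForm R d) : BinaryForm R d := fun i =>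
  (F.eval (C (u⁻¹.1 0 0) * X + C (u⁻¹.1 0 1)) (C (u⁻¹.1 1 0) * X + C (u⁻¹.1 1 1)) : R[X]).coeff i

theorem BinaryForm.eval_act (u : GL (Fin 2) R) (F : BinaryForm R d) (x z : T) :
    (F.act u).eval x z = F.eval
      (algebraMap R T (u⁻¹.1 0 0) * x + algebraMap R T (u⁻¹.1 0 1) * z)
      (algebraMap R T (u⁻¹.1 1 0) * x + algebraMap R T (u⁻¹.1 1 1) * z) := by
  set v := u⁻¹.1
  let L (i : Fin 2) : MvPolynomial (Fin 2) R :=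
    MvPolynomial.C (v i 0) * MvPolynomial.X 0 + MvPolynomial.C (v i 1) * MvPolynomial.X 1
  have hL (i) : (L i).IsHomogeneous 1 := by
    refine .add ?_ ?_
    · simpa using (MvPolynomial.isHomogeneous_C (Fin 2) (v i 0)).mul (MvPolynomial.isHomogeneous_X R 0)
    · simpa using (MvPolynomial.isHomogeneous_C (Fin 2) (v i 1)).mul (MvPolynomial.isHomogeneous_X R 1)
  have hq : (F.eval (L 0) (L 1)).IsHomogeneous d := by
    refine MvPolynomial.IsHomogeneous.sum _ _ _ fun i _ => ?_
    have := ((MvPolynomial.isHomogeneous_C (Fin 2) (F i)).mul ((hL 0).pow (i : ℕ))).mul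
      ((hL 1).pow (d - i))
    have e : 0 + 1 * (i : ℕ) + 1 * (d - i) = d := by have := i.2; omega
    rwa [e] at this
  have key := Polynomial.homogenize_eq_of_isHomogeneous hq rfl
  have h2 : MvPolynomial.aeval ![X, 1] (F.eval (L 0) (L 1)) =
      (F.eval (C (v 0 0) * X + C (v 0 1)) (C (v 1 0) * X + C (v 1 1)) : R[X]) := by
    rw [BinaryForm.map_eval]; simp [L, Polynomial.C_eq_algebraMap]
  rw [h2] at key
  have h3 := congrArg (MvPolynomial.aeval (R := R) ![x, z]) key
  rw [BinaryForm.map_eval] at h3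
  convert h3 using 1
  · simp only [Polynomial.homogenize, map_sum]
    rw [Finset.Nat.sum_antidiagonal_eq_sum_range_succ_mk, Finset.sum_range]
    refine Finset.sum_congr rfl fun i _ => ?_
    rw [MvPolynomial.aeval_monomial]
    simp [Finsupp.update_eq_add_single, pow_add, Finsupp.prod_fintype]
    rw [mul_assoc]; rfl
  · simp [L]

theorem BinaryForm.eval_act_apply (u : GL (Fin 2) R) (F : BinaryForm R d) (x z : T) :
    (F.act u).eval (algebraMap R T (u.1 0 0) * x + algebraMap R T (u.1 0 1) * z)
      (algebraMap R T (u.1 1 0) * x + algebraMap R T (u.1 1 1) * z) = F.eval x z := by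
  have h : u⁻¹.1 * u.1 = 1 := u.inv_mul
  have e (i j : Fin 2) : algebraMap R T (u⁻¹.1 i 0) * algebraMap R T (u.1 0 j) +
      algebraMap R T (u⁻¹.1 i 1) * algebraMap R T (u.1 1 j) =
        algebraMap R T ((1 : Matrix (Fin 2) (Fin 2) R) i j) := by
    rw [← h, Matrix.mul_apply, Fin.sum_univ_two, map_add, map_mul, map_mul]
  rw [BinaryForm.eval_act]
  congr 1
  · have h0 := e 0 0
    have h1 := e 0 1
    simp only [ne_eq, zero_ne_one, not_false_eq_true, Matrix.one_apply_eq, Matrix.one_apply_ne, map_one, map_zero] at h0 h1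
    linear_combination x * h0 + z * h1
  · have h0 := e 1 0
    have h1 := e 1 1
    simp only [ne_eq, one_ne_zero, not_false_eq_true, Matrix.one_apply_eq, Matrix.one_apply_ne, map_one, map_zero] at h0 h1
    linear_combination x * h0 + z * h1

end Forms

/-! ## The curve `y² = F(x, z)` -/

section Curve
variable {R : Type*} [CommRing R] {g d : ℕ}

/-- The coordinate ring `R[x, y] / (y² - F(x, 1))` of the chart `z ≠ 0` of the curve
`C_F : y² = F(x, z)` in the weighted projective plane `ℙ(1, d/2, 1)`. The coordinate ring of the
chart `x ≠ 0` is `ChartRing F.rev`; these two charts cover `C_F`. -/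
abbrev ChartRing (F : BinaryForm R d) : Type _ :=
  AdjoinRoot (X ^ 2 - C (F.eval X 1) : R[X][X])

/-- The function `x` on the chart. -/
def chartX (F : BinaryForm R d) : ChartRing F := AdjoinRoot.of _ X

/-- The function `y` on the chart. -/
def chartY (F : BinaryForm R d) : ChartRing F := AdjoinRoot.root _

theorem chartY_sq (F : BinaryForm R d) : chartY F ^ 2 = F.eval (chartX F) 1 := by
  have h := AdjoinRoot.eval₂_root (X ^ 2 - C (F.eval X 1) : R[X][X])
  rw [Polynomial.eval₂_sub, Polynomial.eval₂_pow, Polynomial.eval₂_X, Polynomial.eval₂_C,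
    sub_eq_zero] at h
  refine h.trans ?_
  change (AdjoinRoot.ofAlgHom R (X ^ 2 - C (F.eval X 1) : R[X][X])) (F.eval X 1) = _
  rw [BinaryForm.map_eval, map_one]
  rfl

variable {T T' : Type*} [CommRing T] [Algebra R T] [CommRing T'] [Algebra R T']

/-- The `T`-valued point of the chart with coordinates `(x, y)`. -/
def chartHom (F : BinaryForm R d) (x y : T) (h : y ^ 2 = F.eval x 1) : ChartRing F →ₐ[R] T :=
  AdjoinRoot.liftAlgHom _ (aeval x) y (by
    rw [Polynomial.eval₂_sub, Polynomial.eval₂_pow, Polynomial.eval₂_X, Polynomial.eval₂_C, h]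
    change _ - aeval x (F.eval X 1) = 0
    rw [BinaryForm.map_eval]; simp)

theorem chartHom_X (F : BinaryForm R d) (x y : T) (h : y ^ 2 = F.eval x 1) :
    chartHom F x y h (chartX F) = x := by
  simp [chartHom, chartX]

theorem chartHom_Y (F : BinaryForm R d) (x y : T) (h : y ^ 2 = F.eval x 1) :
    chartHom F x y h (chartY F) = y := by
  simp [chartHom, chartY]

theorem chart_ext {F : BinaryForm R d} {φ ψ : ChartRing F →ₐ[R] T}
    (hx : φ (chartX F) = ψ (chartX F)) (hy : φ (chartY F) = ψ (chartY F)) : φ = ψ := by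
  refine AdjoinRoot.algHom_ext' ?_ hy
  exact Polynomial.algHom_ext hx

/-- The point of the chart `z ≠ 0` with weighted homogeneous coordinates `(x : y : z)`, that is,
with affine coordinates `(x / z, y / z^(g+1))`. -/
def toChart (F : BinaryForm R (2 * g + 2)) (x y : T) (z : Tˣ) (h : y ^ 2 = F.eval x (z : T)) :
    ChartRing F →ₐ[R] T :=
  chartHom F (↑z⁻¹ * x) (↑z⁻¹ ^ (g + 1) * y) (by
    have e := F.eval_mul (↑z⁻¹ : T) x z
    rw [Units.inv_mul] at e
    rw [e, ← h]; ring)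

theorem comp_toChart (F : BinaryForm R (2 * g + 2)) (ψ : T →ₐ[R] T') (x y : T) (z : Tˣ)
    (h : y ^ 2 = F.eval x (z : T)) (x' y' : T') (z' : T'ˣ) (h' : y' ^ 2 = F.eval x' (z' : T'))
    (hx : ψ x = x') (hy : ψ y = y') (hz : ψ z = z') (a : ChartRing F) :
    toChart F x' y' z' h' a = ψ (toChart F x y z h a) := by
  have hz' : (↑z'⁻¹ : T') = ψ ↑z⁻¹ := by
    rw [Units.inv_eq_of_mul_eq_one_right]
    rw [← hz, ← map_mul, Units.mul_inv, map_one]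
  have : toChart F x' y' z' h' = ψ.comp (toChart F x y z h) := by
    apply chart_ext <;>
      simp [toChart, chartHom_X, chartHom_Y, hx, hy, hz']
  rw [this]; rfl

theorem toChart_scale (F : BinaryForm R (2 * g + 2)) (x y : T) (z c : Tˣ)
    (h : y ^ 2 = F.eval x (z : T)) (x' y' : T) (z' : Tˣ) (h' : y' ^ 2 = F.eval x' (z' : T))
    (hx : x' = c * x) (hy : y' = c ^ (g + 1) * y) (hz : z' = c * z) :
    toChart F x' y' z' h' = toChart F x y z h := by
  subst hx hy hz
  apply chart_ext
  · simp only [toChart, chartHom_X, mul_inv, Units.val_mul]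
    linear_combination (↑z⁻¹ * x) * c.inv_mul
  · simp only [toChart, chartHom_Y, mul_inv, Units.val_mul]
    have : (↑c⁻¹ * ↑z⁻¹ : T) ^ (g + 1) * (↑c ^ (g + 1) * y) =
      (↑c⁻¹ * ↑c : T) ^ (g + 1) * (↑z⁻¹ ^ (g + 1) * y) := by ring
    rw [this, Units.inv_mul, one_pow, one_mul]

/-- The coordinate ring of the overlap of the two charts. -/
abbrev OverlapRing (F : BinaryForm R d) : Type _ := Localization.Away (chartX F)

/-- The function `x` on the overlap of the two charts, where it is invertible. -/
def overlapX (F : BinaryForm R d) : (OverlapRing F)ˣ :=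
  (IsLocalization.Away.algebraMap_isUnit (S := OverlapRing F) (chartX F)).unit

theorem overlap_eq (F : BinaryForm R d) : algebraMap (ChartRing F) (OverlapRing F) (chartY F) ^ 2 =
    F.rev.eval 1 (overlapX F : OverlapRing F) := by
  rw [BinaryForm.eval_rev, ← map_pow, chartY_sq]
  have := F.map_eval (IsScalarTower.toAlgHom R (ChartRing F) (OverlapRing F)) (chartX F) 1
  simpa [overlapX] using this

/-- The inclusion of the overlap into the chart `z ≠ 0`. -/
def overlapLeft (F : BinaryForm R d) : ChartRing F →ₐ[R] OverlapRing F :=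
  IsScalarTower.toAlgHom R (ChartRing F) (OverlapRing F)

/-- The inclusion of the overlap into the chart `x ≠ 0`: the point `(x : y : 1)` has there the
coordinates `(1 / x, y / x^(g+1))`. -/
def overlapRight (F : BinaryForm R (2 * g + 2)) : ChartRing F.rev →ₐ[R] OverlapRing F :=
  toChart F.rev 1 (algebraMap (ChartRing F) (OverlapRing F) (chartY F)) (overlapX F) (overlap_eq F)

/-- The `R`-module `H⁰(C_F, Ω¹_{C_F/R})` of global relative differentials on the curve
`C_F : y² = F(x, z)` over `R`: pairs of differentials on the two charts which agree on the
overlap. -/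
def globalDifferentials (F : BinaryForm R (2 * g + 2)) :
    Submodule R (Ω[ChartRing F⁄R] × Ω[ChartRing F.rev⁄R]) :=
  LinearMap.eqLocus ((pull (overlapLeft F)).comp (LinearMap.fst R _ _))
    ((pull (overlapRight F)).comp (LinearMap.snd R _ _))

theorem pull_toChart_eq (F : BinaryForm R (2 * g + 2)) (η : globalDifferentials F)
    (y : T) (x z : Tˣ) (h : y ^ 2 = F.eval (x : T) (z : T)) (h' : y ^ 2 = F.rev.eval (z : T) (x : T)) :
    pull (toChart F (x : T) y z h) η.1.1 = pull (toChart F.rev (z : T) y x h') η.1.2 := by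
  have hu : IsUnit (toChart F (x : T) y z h (chartX F)) := by
    simp [toChart, chartHom_X]
  obtain ⟨χ, hχ⟩ : ∃ χ : OverlapRing F →ₐ[R] T,
      ∀ a : ChartRing F, χ (algebraMap _ _ a) = toChart F (x : T) y z h a :=
    ⟨IsLocalization.liftAlgHom (M := Submonoid.powers (chartX F)) (f := toChart F (x : T) y z h)
      (by rintro ⟨_, n, rfl⟩; simpa using hu.pow n), fun a => by simp⟩
  have hη : pull (overlapLeft F) η.1.1 = pull (overlapRight F) η.1.2 := η.2
  have h2 := congrArg (pull χ) hη
  rw [pull_pull χ _ (toChart F (x : T) y z h) (fun a => (hχ a).symm)] at h2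
  rw [h2]
  apply pull_pull
  intro a
  have hX : χ (overlapX F : OverlapRing F) = ↑z⁻¹ * ↑x := by
    change χ (algebraMap _ _ (chartX F)) = _
    rw [hχ]; simp [toChart, chartHom_X]
  have hY : χ (algebraMap _ _ (chartY F)) = ↑z⁻¹ ^ (g + 1) * y := by
    rw [hχ]; simp [toChart, chartHom_Y]
  have h'' : (↑z⁻¹ ^ (g + 1) * y) ^ 2 = F.rev.eval (1 : T) ((z⁻¹ * x : Tˣ) : T) := by
    have e := F.rev.eval_mul (↑z⁻¹ : T) z x
    rw [Units.inv_mul] at e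
    rw [Units.val_mul, e, ← h']; ring
  change _ = χ (toChart F.rev 1 _ (overlapX F) (overlap_eq F) a)
  rw [← comp_toChart F.rev χ 1 _ (overlapX F) (overlap_eq F) 1 (↑z⁻¹ ^ (g + 1) * y) (z⁻¹ * x) h''
    (map_one _) hY (by rw [hX]; simp) a]
  rw [toChart_scale F.rev (z : T) y x z⁻¹ h' 1 (↑z⁻¹ ^ (g + 1) * y) (z⁻¹ * x) h'' (by simp) rfl (by simp)]

end Curve

/-! ## Pullback of global differentials to a point of the curve -/

section PullbackAt
variable {R T : Type u} [CommRing R] [CommRing T] [Algebra R T] {g : ℕ}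

/-- `m` is the pullback of the global differential `η` on `C_F` along the morphism
`(x : y : z) : Spec T → C_F`, where `y² = F(x, z)` and `x`, `z` generate the unit ideal of `T`:
wherever `z` is invertible it is the pullback of the first component of `η`, and
wherever `x` is invertible it is the pullback of the second one. -/
def IsPullbackAt (F : BinaryForm R (2 * g + 2)) (η : globalDifferentials F) (x y z : T)
    (m : Ω[T⁄R]) : Prop :=
  (∀ (T' : Type u) [CommRing T'] [Algebra R T'] (ψ : T →ₐ[R] T') (z' : T'ˣ)
    (h : ψ y ^ 2 = F.eval (ψ x) (z' : T')), ψ z = z' →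
      pull ψ m = pull (toChart F (ψ x) (ψ y) z' h) η.1.1) ∧
  (∀ (T' : Type u) [CommRing T'] [Algebra R T'] (ψ : T →ₐ[R] T') (x' : T'ˣ)
    (h : ψ y ^ 2 = F.rev.eval (ψ z) (x' : T')), ψ x = x' →
      pull ψ m = pull (toChart F.rev (ψ z) (ψ y) x' h) η.1.2)

theorem point_map {T' : Type u} [CommRing T'] [Algebra R T'] {F : BinaryForm R (2 * g + 2)}
    {x y z : T} (h : y ^ 2 = F.eval x z) (ψ : T →ₐ[R] T') : ψ y ^ 2 = F.eval (ψ x) (ψ z) := by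
  rw [← map_pow, h, BinaryForm.map_eval]

theorem point_map' {T' : Type u} [CommRing T'] [Algebra R T'] {F : BinaryForm R (2 * g + 2)}
    {x y z : T} (h : y ^ 2 = F.eval x z) (ψ : T →ₐ[R] T') : ψ y ^ 2 = F.rev.eval (ψ z) (ψ x) := by
  rw [BinaryForm.eval_rev, point_map h]

theorem isPullbackAt_unique {F : BinaryForm R (2 * g + 2)} {η : globalDifferentials F} {x y z : T}
    (h : y ^ 2 = F.eval x z) (hxz : IsCoprime x z) {m n : Ω[T⁄R]}
    (hm : IsPullbackAt F η x y z m) (hn : IsPullbackAt F η x y z n) : m = n := by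
  have hz : IsUnit (algebraMap T (Localization.Away z) z) :=
    IsLocalization.Away.algebraMap_isUnit z
  have hx : IsUnit (algebraMap T (Localization.Away x) x) :=
    IsLocalization.Away.algebraMap_isUnit x
  refine glue_sep hxz (KaehlerDifferential.map R R T (Localization.Away z))
    (KaehlerDifferential.map R R T (Localization.Away x)) ?_ ?_
  · rw [← pull_toAlgHom, ← pull_toAlgHom]
    have e := point_map h (IsScalarTower.toAlgHom R T (Localization.Away z))
    rw [hm.1 _ _ hz.unit e rfl, hn.1 _ _ hz.unit e rfl]
  · rw [← pull_toAlgHom, ← pull_toAlgHom]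
    have e := point_map' h (IsScalarTower.toAlgHom R T (Localization.Away x))
    rw [hm.2 _ _ hx.unit e rfl, hn.2 _ _ hx.unit e rfl]

/-- The factorization of `T → T'` through the localization at an element that becomes a unit. -/
theorem exists_away_lift {T' : Type u} [CommRing T'] [Algebra R T'] (ψ : T →ₐ[R] T') (x : T)
    (hx : IsUnit (ψ x)) : ∃ χ : Localization.Away x →ₐ[R] T',
      ∀ a, χ (algebraMap T (Localization.Away x) a) = ψ a :=
  ⟨IsLocalization.liftAlgHom (M := Submonoid.powers x) (f := ψ)
      (by rintro ⟨_, n, rfl⟩; simpa using hx.pow n), fun a => by simp⟩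

theorem exists_isPullbackAt (F : BinaryForm R (2 * g + 2)) (η : globalDifferentials F) (x y z : T)
    (h : y ^ 2 = F.eval x z) (hxz : IsCoprime x z) : ∃ m, IsPullbackAt F η x y z m := by
  have hz : IsUnit (algebraMap T (Localization.Away z) z) :=
    IsLocalization.Away.algebraMap_isUnit z
  have hx : IsUnit (algebraMap T (Localization.Away x) x) :=
    IsLocalization.Away.algebraMap_isUnit x
  have hzx : IsUnit (algebraMap T (Localization.Away (z * x)) (z * x)) :=
    IsLocalization.Away.algebraMap_isUnit (z * x)
  rw [map_mul, IsUnit.mul_iff] at hzx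
  let ιz := IsScalarTower.toAlgHom R T (Localization.Away z)
  let ιx := IsScalarTower.toAlgHom R T (Localization.Away x)
  let ιzx := IsScalarTower.toAlgHom R T (Localization.Away (z * x))
  obtain ⟨χz, hχz⟩ := exists_away_lift ιzx z hzx.1
  obtain ⟨χx, hχx⟩ := exists_away_lift ιzx x hzx.2
  have ez : ιz y ^ 2 = F.eval (ιz x) (hz.unit : Localization.Away z) := point_map h ιz
  have ex : ιx y ^ 2 = F.rev.eval (ιx z) (hx.unit : Localization.Away x) := point_map' h ιx
  have ezx : ιzx y ^ 2 = F.eval (hzx.2.unit : Localization.Away (z * x))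
    (hzx.1.unit : Localization.Away (z * x)) := point_map h ιzx
  have ezx' : ιzx y ^ 2 = F.rev.eval (hzx.1.unit : Localization.Away (z * x))
    (hzx.2.unit : Localization.Away (z * x)) := point_map' h ιzx
  have comm : pull χz (pull (toChart F (ιz x) (ιz y) hz.unit ez) η.1.1) =
      pull χx (pull (toChart F.rev (ιx z) (ιx y) hx.unit ex) η.1.2) := by
    rw [pull_pull χz _ (toChart F (hzx.2.unit : Localization.Away (z * x)) (ιzx y) hzx.1.unit ezx)
        (comp_toChart F χz (ιz x) (ιz y) hz.unit ez _ _ _ ezx (hχz x) (hχz y) (hχz z)),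
      pull_pull χx _ (toChart F.rev (hzx.1.unit : Localization.Away (z * x)) (ιzx y)
        hzx.2.unit ezx') (comp_toChart F.rev χx (ιx z) (ιx y) hx.unit ex _ _ _ ezx' (hχx z) (hχx y) (hχx x))]
    exact pull_toChart_eq F η _ _ _ _ _
  let rz : Ω[Localization.Away z⁄R] →ₗ[T] Ω[Localization.Away (z * x)⁄R] :=
    { toFun := pull χz
      map_add' := map_add _
      map_smul' := fun t m => by
        rw [← algebraMap_smul (Localization.Away z) t m, pull_smul, hχz]
        exact algebraMap_smul (Localization.Away (z * x)) t (pull χz m) }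
  let rx : Ω[Localization.Away x⁄R] →ₗ[T] Ω[Localization.Away (z * x)⁄R] :=
    { toFun := pull χx
      map_add' := map_add _
      map_smul' := fun t m => by
        rw [← algebraMap_smul (Localization.Away x) t m, pull_smul, hχx]
        exact algebraMap_smul (Localization.Away (z * x)) t (pull χx m) }
  obtain ⟨m, hmz, hmx⟩ := glue_exists hxz (KaehlerDifferential.map R R T (Localization.Away z))
    (KaehlerDifferential.map R R T (Localization.Away x))
    (KaehlerDifferential.map R R T (Localization.Away (z * x))) rz rx
    (fun m => by
      rw [← pull_toAlgHom, ← pull_toAlgHom]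
      exact pull_pull χz _ _ (fun a => (hχz a).symm) m)
    (fun m => by
      rw [← pull_toAlgHom, ← pull_toAlgHom]
      exact pull_pull χx _ _ (fun a => (hχx a).symm) m)
    (pull (toChart F (ιz x) (ιz y) hz.unit ez) η.1.1)
    (pull (toChart F.rev (ιx z) (ιx y) hx.unit ex) η.1.2) comm
  rw [← pull_toAlgHom] at hmz hmx
  refine ⟨m, ?_, ?_⟩
  · intro T' _ _ ψ z' h' hz'
    obtain ⟨χ, hχ⟩ := exists_away_lift ψ z (hz' ▸ z'.isUnit)
    rw [← pull_pull χ ιz ψ (fun a => (hχ a).symm) m, hmz]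
    exact pull_pull _ _ _ (comp_toChart F χ _ _ _ _ _ _ _ _ (hχ x) (hχ y) ((hχ z).trans hz')) _
  · intro T' _ _ ψ x' h' hx'
    obtain ⟨χ, hχ⟩ := exists_away_lift ψ x (hx' ▸ x'.isUnit)
    rw [← pull_pull χ ιx ψ (fun a => (hχ a).symm) m, hmx]
    exact pull_pull _ _ _
      (comp_toChart F.rev χ _ _ _ _ _ _ _ _ (hχ z) (hχ y) ((hχ x).trans hx')) _

/-- The pullback of global differentials on `C_F` along the morphism
`(x : y : z) : Spec T → C_F`. -/
def pullbackAt (F : BinaryForm R (2 * g + 2)) (x y z : T) (h : y ^ 2 = F.eval x z)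
    (hxz : IsCoprime x z) : globalDifferentials F →ₗ[R] Ω[T⁄R] where
  toFun η := (exists_isPullbackAt F η x y z h hxz).choose
  map_add' η θ := by
    have hη := (exists_isPullbackAt F η x y z h hxz).choose_spec
    have hθ := (exists_isPullbackAt F θ x y z h hxz).choose_spec
    refine isPullbackAt_unique h hxz (exists_isPullbackAt F (η + θ) x y z h hxz).choose_spec ⟨?_, ?_⟩
    · intro T' _ _ ψ z' h' hz'
      rw [map_add, hη.1 T' ψ z' h' hz', hθ.1 T' ψ z' h' hz', ← map_add]; rfl
    · intro T' _ _ ψ x' h' hx'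
      rw [map_add, hη.2 T' ψ x' h' hx', hθ.2 T' ψ x' h' hx', ← map_add]; rfl
  map_smul' r η := by
    have hη := (exists_isPullbackAt F η x y z h hxz).choose_spec
    refine isPullbackAt_unique h hxz (exists_isPullbackAt F (r • η) x y z h hxz).choose_spec ⟨?_, ?_⟩
    · intro T' _ _ ψ z' h' hz'
      rw [RingHom.id_apply, map_smul, hη.1 T' ψ z' h' hz', ← map_smul]; rfl
    · intro T' _ _ ψ x' h' hx'
      rw [RingHom.id_apply, map_smul, hη.2 T' ψ x' h' hx', ← map_smul]; rfl

theorem pullbackAt_spec (F : BinaryForm R (2 * g + 2)) (x y z : T) (h : y ^ 2 = F.eval x z)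
    (hxz : IsCoprime x z) (η : globalDifferentials F) :
    IsPullbackAt F η x y z (pullbackAt F x y z h hxz η) :=
  (exists_isPullbackAt F η x y z h hxz).choose_spec

theorem pullbackAt_eq_iff {F : BinaryForm R (2 * g + 2)} {x y z : T} {h : y ^ 2 = F.eval x z}
    {hxz : IsCoprime x z} {η : globalDifferentials F} {m : Ω[T⁄R]} :
    pullbackAt F x y z h hxz η = m ↔ IsPullbackAt F η x y z m :=
  ⟨fun e => e ▸ pullbackAt_spec F x y z h hxz η,
    fun e => isPullbackAt_unique h hxz (pullbackAt_spec F x y z h hxz η) e⟩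

theorem pull_pullbackAt {T₁ : Type u} [CommRing T₁] [Algebra R T₁]
    (F : BinaryForm R (2 * g + 2)) (φ : T →ₐ[R] T₁) (c : T₁ˣ) (x y z : T) (h : y ^ 2 = F.eval x z)
    (hxz : IsCoprime x z) (x₁ y₁ z₁ : T₁) (h₁ : y₁ ^ 2 = F.eval x₁ z₁) (hxz₁ : IsCoprime x₁ z₁)
    (hx : φ x = c * x₁) (hy : φ y = c ^ (g + 1) * y₁) (hz : φ z = c * z₁)
    (η : globalDifferentials F) :
    pull φ (pullbackAt F x y z h hxz η) = pullbackAt F x₁ y₁ z₁ h₁ hxz₁ η := by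
  symm
  rw [pullbackAt_eq_iff]
  have hs := pullbackAt_spec F x y z h hxz η
  refine ⟨?_, ?_⟩
  · intro T' _ _ ψ z' h' hz'
    have e : (ψ.comp φ) z = (Units.map (ψ : T₁ →* T') c * z' : T'ˣ) := by
      simp [hz, hz']
    have := hs.1 T' (ψ.comp φ) _ (e ▸ point_map h (ψ.comp φ)) e
    rw [pull_pull ψ φ (ψ.comp φ) (fun _ => rfl), this,
      toChart_scale F (ψ x₁) (ψ y₁) z' (Units.map (ψ : T₁ →* T') c) h' _ _ _ _ (by simp [hx])
        (by simp [hy]) rfl]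
  · intro T' _ _ ψ x' h' hx'
    have e : (ψ.comp φ) x = (Units.map (ψ : T₁ →* T') c * x' : T'ˣ) := by
      simp [hx, hx']
    have := hs.2 T' (ψ.comp φ) _ (e ▸ point_map' h (ψ.comp φ)) e
    rw [pull_pull ψ φ (ψ.comp φ) (fun _ => rfl), this,
      toChart_scale F.rev (ψ z₁) (ψ y₁) x' (Units.map (ψ : T₁ →* T') c) h' _ _ _ _ (by simp [hz])
        (by simp [hy]) rfl]

end PullbackAt

/-! ## Powers of modules -/

section Powers
variable {R S M N : Type*} [CommRing R] [CommRing S] [AddCommGroup M] [Module R M]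
  [AddCommGroup N] [Module S N]

/-- The map `m₁ ∧ ⋯ ∧ mₙ ↦ φ(m₁) ∧ ⋯ ∧ φ(mₙ)` induced by a semilinear map `φ`. -/
def extMap {f : R →+* S} (n : ℕ) (φ : M →ₛₗ[f] N) : ⋀[R]^n M →ₛₗ[f] ⋀[S]^n N :=
  letI : Module R (⋀[S]^n N) := Module.compHom _ f
  let a : M [⋀^Fin n]→ₗ[R] (⋀[S]^n N) :=
    { toFun := fun v => exteriorPower.ιMulti S n (φ ∘ v)
      map_update_add' := fun v i x y => by
        simp only [Function.comp_update, map_add, AlternatingMap.map_update_add]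
      map_update_smul' := fun v i c x => by
        simp only [Function.comp_update, map_smulₛₗ, AlternatingMap.map_update_smul]
        rfl
      map_eq_zero_of_eq' := fun v i j hv hij =>
        (exteriorPower.ιMulti S n).map_eq_zero_of_eq _ (by simp [hv]) hij }
  { toFun := exteriorPower.alternatingMapLinearEquiv a
    map_add' := map_add _
    map_smul' := fun c m => (exteriorPower.alternatingMapLinearEquiv a).map_smul c m }

theorem extMap_ιMulti {f : R →+* S} (n : ℕ) (φ : M →ₛₗ[f] N) (v : Fin n → M) :
    extMap n φ (exteriorPower.ιMulti R n v) = exteriorPower.ιMulti S n (φ ∘ v) := by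
  let _ : Module R (⋀[S]^n N) := Module.compHom _ f
  exact exteriorPower.alternatingMapLinearEquiv_apply_ιMulti _ v

/-- The map `m₁ ⊗ ⋯ ⊗ mₕ ↦ φ(m₁) ⊗ ⋯ ⊗ φ(mₕ)` induced by a semilinear map `φ`. -/
def tensorMap {f : R →+* S} (n : ℕ) (φ : M →ₛₗ[f] N) : (⨂[R]^n M) →ₛₗ[f] (⨂[S]^n N) :=
  letI : Module R (⨂[S]^n N) := Module.compHom _ f
  let a : MultilinearMap R (fun _ : Fin n => M) (⨂[S]^n N) :=
    { toFun := fun v => PiTensorProduct.tprod S (φ ∘ v)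
      map_update_add' := fun v i x y => by
        simp only [Function.comp_update, map_add, MultilinearMap.map_update_add]
      map_update_smul' := fun v i c x => by
        simp only [Function.comp_update, map_smulₛₗ, MultilinearMap.map_update_smul]
        rfl }
  { toFun := PiTensorProduct.lift a
    map_add' := map_add _
    map_smul' := fun c m => (PiTensorProduct.lift a).map_smul c m }

theorem tensorMap_tprod {f : R →+* S} (n : ℕ) (φ : M →ₛₗ[f] N) (v : Fin n → M) :
    tensorMap n φ (PiTensorProduct.tprod R v) = PiTensorProduct.tprod S (φ ∘ v) := by
  let _ : Module R (⨂[S]^n N) := Module.compHom _ f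
  exact PiTensorProduct.lift.tprod v

end Powers

/-! ## The action of `GL₂` and base change -/

section Functoriality
variable {g : ℕ}

section Action
variable {R T : Type u} [CommRing R] [CommRing T] [Algebra R T]

/-- The linear form with coefficients the `i`-th row of `u`: the coordinates of the vector
`u(x, z)` are `linForm u 0 x z` and `linForm u 1 x z`. -/
def linForm (u : GL (Fin 2) R) (i : Fin 2) (x z : T) : T :=
  algebraMap R T (u.1 i 0) * x + algebraMap R T (u.1 i 1) * z

theorem map_linForm {T' : Type u} [CommRing T'] [Algebra R T'] (ψ : T →ₐ[R] T')
    (u : GL (Fin 2) R) (i : Fin 2) (x z : T) : ψ (linForm u i x z) = linForm u i (ψ x) (ψ z) := by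
  simp [linForm]

theorem linForm_mul (u : GL (Fin 2) R) (i : Fin 2) (c x z : T) :
    linForm u i (c * x) (c * z) = c * linForm u i x z := by
  simp only [linForm]; ring

theorem linForm_coprime (u : GL (Fin 2) R) {x z : T} (hxz : IsCoprime x z) :
    IsCoprime (linForm u 0 x z) (linForm u 1 x z) := by
  obtain ⟨a, b, hab⟩ := hxz
  have h : u⁻¹.1 * u.1 = 1 := u.inv_mul
  have e (i j : Fin 2) : algebraMap R T (u⁻¹.1 i 0) * algebraMap R T (u.1 0 j) +
      algebraMap R T (u⁻¹.1 i 1) * algebraMap R T (u.1 1 j) =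
        algebraMap R T ((1 : Matrix (Fin 2) (Fin 2) R) i j) := by
    rw [← h, Matrix.mul_apply, Fin.sum_univ_two, map_add, map_mul, map_mul]
  have e00 := e 0 0
  have e01 := e 0 1
  have e10 := e 1 0
  have e11 := e 1 1
  simp only [ne_eq, zero_ne_one, one_ne_zero, not_false_eq_true, Matrix.one_apply_eq,
    Matrix.one_apply_ne, map_one, map_zero] at e00 e01 e10 e11
  refine ⟨a * algebraMap R T (u⁻¹.1 0 0) + b * algebraMap R T (u⁻¹.1 1 0),
    a * algebraMap R T (u⁻¹.1 0 1) + b * algebraMap R T (u⁻¹.1 1 1), ?_⟩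
  simp only [linForm]
  linear_combination hab + a * x * e00 + a * z * e01 + b * x * e10 + b * z * e11

theorem chart_point (F F' : BinaryForm R (2 * g + 2)) (u : GL (Fin 2) R) (hF : F' = F.act u) :
    chartY F ^ 2 = F'.eval (linForm u 0 (chartX F) 1) (linForm u 1 (chartX F) 1) := by
  rw [hF, chartY_sq]
  exact (F.eval_act_apply u (chartX F) 1).symm

theorem chart_point_rev (F F' : BinaryForm R (2 * g + 2)) (u : GL (Fin 2) R) (hF : F' = F.act u) :
    chartY F.rev ^ 2 =
      F'.eval (linForm u 0 1 (chartX F.rev)) (linForm u 1 1 (chartX F.rev)) := by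
  rw [hF, chartY_sq, BinaryForm.eval_rev]
  exact (F.eval_act_apply u 1 (chartX F.rev)).symm

theorem pullbackAct_aux (u : GL (Fin 2) R) (F F' : BinaryForm R (2 * g + 2)) (hF : F' = F.act u)
    (η : globalDifferentials F') :
    pull (overlapLeft F) (pullbackAt F' (linForm u 0 (chartX F) 1) (chartY F)
        (linForm u 1 (chartX F) 1) (chart_point F F' u hF)
        (linForm_coprime u isCoprime_one_right) η) =
      pull (overlapRight F) (pullbackAt F' (linForm u 0 1 (chartX F.rev)) (chartY F.rev)
        (linForm u 1 1 (chartX F.rev)) (chart_point_rev F F' u hF)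
        (linForm_coprime u isCoprime_one_left) η) := by
  have hX : overlapLeft F (chartX F) = overlapX F := rfl
  have h₁ : overlapLeft F (chartY F) ^ 2 =
      F'.eval (linForm u 0 (overlapX F : OverlapRing F) 1) (linForm u 1 ↑(overlapX F) 1) := by
    rw [← map_pow, chart_point F F' u hF, BinaryForm.map_eval, map_linForm, map_linForm,
      map_one, hX]
  have h₂ := linForm_coprime (T := OverlapRing F) u (x := overlapX F) isCoprime_one_right
  have hX' : overlapRight F (chartX F.rev) = ↑(overlapX F)⁻¹ := by
    simp [overlapRight, toChart, chartHom_X]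
  have hY' : overlapRight F (chartY F.rev) =
      ↑(overlapX F)⁻¹ ^ (g + 1) * overlapLeft F (chartY F) := by
    simp only [overlapRight, toChart, chartHom_Y]; rfl
  have hl (i : Fin 2) : linForm u i 1 (↑(overlapX F)⁻¹ : OverlapRing F) =
      ↑(overlapX F)⁻¹ * linForm u i ↑(overlapX F) 1 := by
    rw [← linForm_mul, Units.inv_mul, mul_one]
  rw [pull_pullbackAt F' (overlapLeft F) 1 _ _ _ _ _ _ _ _ h₁ h₂ (by rw [map_linForm, hX]; simp)
      (by simp) (by rw [map_linForm, hX]; simp) η,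
    pull_pullbackAt F' (overlapRight F) (overlapX F)⁻¹ _ _ _ _ _ _ _ _ h₁ h₂
      (by rw [map_linForm, map_one, hX', hl]) hY' (by rw [map_linForm, map_one, hX', hl]) η]

/-- The pullback `φ_u^* : H⁰(C_{u·F}, Ω¹) → H⁰(C_F, Ω¹)` along the isomorphism
`φ_u : C_F → C_{u·F}`, `(x, y, z) ↦ (u(x, z), y)`. On the chart `z = 1` of `C_F` it is the
pullback along `(u(x, 1), y)`, on the chart `x = 1` along `(u(1, z), y)`. -/
def pullbackAct (u : GL (Fin 2) R) (F F' : BinaryForm R (2 * g + 2)) (hF : F' = F.act u) :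
    globalDifferentials F' →ₗ[R] globalDifferentials F :=
  LinearMap.codRestrict (globalDifferentials F)
    ((pullbackAt F' (linForm u 0 (chartX F) 1) (chartY F) (linForm u 1 (chartX F) 1)
        (chart_point F F' u hF) (linForm_coprime u isCoprime_one_right)).prod
      (pullbackAt F' (linForm u 0 1 (chartX F.rev)) (chartY F.rev) (linForm u 1 1 (chartX F.rev))
        (chart_point_rev F F' u hF) (linForm_coprime u isCoprime_one_left)))
    (pullbackAct_aux u F F' hF)

end Action

section BaseChange
variable {R S : Type u} [CommRing R] [CommRing S] {d : ℕ}

theorem eval_map (f : R →+* S) (F : BinaryForm R d) (F' : BinaryForm S d)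
    (hF : ∀ i, f (F i) = F' i) (x z : R[X]) :
    mapRingHom f (F.eval x z) = F'.eval (mapRingHom f x) (mapRingHom f z) := by
  simp [BinaryForm.eval, hF]

/-- The ring homomorphism between the coordinate rings of charts given by a homomorphism
`f : R → S` of base rings which maps the form `F` to `F'`. -/
def chartBaseChange (f : R →+* S) (F : BinaryForm R d) (F' : BinaryForm S d)
    (hF : ∀ i, f (F i) = F' i) : ChartRing F →+* ChartRing F' :=
  AdjoinRoot.lift ((AdjoinRoot.of _).comp (mapRingHom f)) (chartY F') (by
    rw [Polynomial.eval₂_sub, Polynomial.eval₂_pow, Polynomial.eval₂_X, Polynomial.eval₂_C,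
      RingHom.comp_apply, eval_map f F F' hF, chartY_sq, sub_eq_zero]
    change _ = (AdjoinRoot.ofAlgHom S (X ^ 2 - C (F'.eval X 1) : S[X][X])) _
    rw [BinaryForm.map_eval]
    simp [chartX])

theorem chartBaseChange_X (f : R →+* S) (F : BinaryForm R d) (F' : BinaryForm S d)
    (hF : ∀ i, f (F i) = F' i) : chartBaseChange f F F' hF (chartX F) = chartX F' := by
  simp [chartBaseChange, chartX]

theorem chartBaseChange_Y (f : R →+* S) (F : BinaryForm R d) (F' : BinaryForm S d)
    (hF : ∀ i, f (F i) = F' i) : chartBaseChange f F F' hF (chartY F) = chartY F' := by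
  simp [chartBaseChange, chartY]

theorem chartBaseChange_algebraMap (f : R →+* S) (F : BinaryForm R d) (F' : BinaryForm S d)
    (hF : ∀ i, f (F i) = F' i) (r : R) :
    chartBaseChange f F F' hF (algebraMap R _ r) = algebraMap S _ (f r) := by
  change chartBaseChange f F F' hF (AdjoinRoot.of _ (C r)) = AdjoinRoot.of _ (C (f r))
  simp [chartBaseChange]

theorem rev_map {f : R →+* S} {F : BinaryForm R d} {F' : BinaryForm S d}
    (hF : ∀ i, f (F i) = F' i) (i : Fin (d + 1)) : f (F.rev i) = F'.rev i := hF _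

theorem exists_overlapBaseChange (f : R →+* S) (F : BinaryForm R (2 * g + 2))
    (F' : BinaryForm S (2 * g + 2)) (hF : ∀ i, f (F i) = F' i) :
    ∃ θ : OverlapRing F →+* OverlapRing F',
      (∀ r, θ (algebraMap R _ r) = algebraMap S _ (f r)) ∧
      (∀ a, θ (overlapLeft F a) = overlapLeft F' (chartBaseChange f F F' hF a)) ∧
      ∀ a, θ (overlapRight F a) =
        overlapRight F' (chartBaseChange f F.rev F'.rev (rev_map hF) a) := by
  let β : ChartRing F →+* OverlapRing F' :=
    (overlapLeft F' : ChartRing F' →+* OverlapRing F').comp (chartBaseChange f F F' hF)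
  have hβ (a) : β a = overlapLeft F' (chartBaseChange f F F' hF a) := rfl
  have hX : β (chartX F) = overlapX F' := by rw [hβ, chartBaseChange_X]; rfl
  let θ : OverlapRing F →+* OverlapRing F' :=
    IsLocalization.Away.lift (chartX F) (g := β) (hX ▸ (overlapX F').isUnit)
  have hθ (a) : θ (overlapLeft F a) = overlapLeft F' (chartBaseChange f F F' hF a) :=
    IsLocalization.Away.lift_eq (chartX F) _ a
  have hθr (r : R) : θ (algebraMap R _ r) = algebraMap S _ (f r) := by
    rw [← (overlapLeft F).commutes, hθ, chartBaseChange_algebraMap, AlgHom.commutes]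
  have hθX : θ (overlapX F) = overlapX F' := by
    change θ (overlapLeft F (chartX F)) = _
    rw [hθ, chartBaseChange_X]; rfl
  have hθX' : θ ↑(overlapX F)⁻¹ = ↑(overlapX F')⁻¹ := by
    rw [eq_comm, Units.inv_eq_of_mul_eq_one_right]
    rw [← hθX, ← map_mul, Units.mul_inv, map_one]
  refine ⟨θ, hθr, hθ, fun a => ?_⟩
  have key : (θ.comp (overlapRight F : ChartRing F.rev →+* OverlapRing F)) =
      (overlapRight F' : ChartRing F'.rev →+* OverlapRing F').comp
        (chartBaseChange f F.rev F'.rev (rev_map hF)) := by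
    refine AdjoinRoot.ringHom_ext (Polynomial.ringHom_ext (fun r => ?_) ?_) ?_
    · change θ (overlapRight F (algebraMap R _ r)) =
        overlapRight F' (chartBaseChange f F.rev F'.rev (rev_map hF) (algebraMap R _ r))
      rw [chartBaseChange_algebraMap, AlgHom.commutes, AlgHom.commutes, hθr]
    · change θ (overlapRight F (chartX F.rev)) =
        overlapRight F' (chartBaseChange f F.rev F'.rev (rev_map hF) (chartX F.rev))
      rw [chartBaseChange_X]
      simp [overlapRight, toChart, chartHom_X, hθX']
    · change θ (overlapRight F (chartY F.rev)) =
        overlapRight F' (chartBaseChange f F.rev F'.rev (rev_map hF) (chartY F.rev))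
      rw [chartBaseChange_Y]
      have h := hθ (chartY F)
      rw [chartBaseChange_Y] at h
      simp only [overlapRight, toChart, chartHom_Y, map_mul, map_pow, hθX']
      exact congrArg _ h
  exact congrArg (fun k : ChartRing F.rev →+* OverlapRing F' => k a) key

/-- The base change `H⁰(C_F, Ω¹_{C_F/R}) → H⁰(C_{F'}, Ω¹_{C_{F'}/S})` along a ring homomorphism
`f : R → S` which maps the form `F` to `F'`: on each chart, `a db ↦ f(a) d(f b)`. -/
def baseChange (f : R →+* S) (F : BinaryForm R (2 * g + 2)) (F' : BinaryForm S (2 * g + 2))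
    (hF : ∀ i, f (F i) = F' i) : globalDifferentials F →ₛₗ[f] globalDifferentials F' where
  toFun η := ⟨(kaehlerMap f (chartBaseChange f F F' hF) (chartBaseChange_algebraMap f F F' hF) η.1.1,
      kaehlerMap f (chartBaseChange f F.rev F'.rev (rev_map hF))
        (chartBaseChange_algebraMap f F.rev F'.rev (rev_map hF)) η.1.2), by
    obtain ⟨θ, hr, hl, hθ⟩ := exists_overlapBaseChange f F F' hF
    have hη : pull (overlapLeft F) η.1.1 = pull (overlapRight F) η.1.2 := η.2
    have e₁ : pull (overlapLeft F') (kaehlerMap f (chartBaseChange f F F' hF)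
        (chartBaseChange_algebraMap f F F' hF) η.1.1) =
          kaehlerMap f θ hr (pull (overlapLeft F) η.1.1) := by
      generalize η.1.1 = m
      induction m using kaehler_induction with
      | h0 => simp
      | hadd m n hm hn => simp only [map_add, hm, hn]
      | hD a b => simp only [map_smulₛₗ, kaehlerMap_D, pull_smul, pull_D, hl]
    have e₂ : pull (overlapRight F') (kaehlerMap f (chartBaseChange f F.rev F'.rev (rev_map hF))
        (chartBaseChange_algebraMap f F.rev F'.rev (rev_map hF)) η.1.2) =
          kaehlerMap f θ hr (pull (overlapRight F) η.1.2) := by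
      generalize η.1.2 = m
      induction m using kaehler_induction with
      | h0 => simp
      | hadd m n hm hn => simp only [map_add, hm, hn]
      | hD a b => simp only [map_smulₛₗ, kaehlerMap_D, pull_smul, pull_D, hθ]
    exact e₁.trans ((congrArg _ hη).trans e₂.symm)⟩
  map_add' η θ := by ext <;> simp
  map_smul' r η := by
    have key {A B : Type u} [CommRing A] [CommRing B] [Algebra R A] [Algebra S B] (φ : A →+* B)
        (h : ∀ r, φ (algebraMap R A r) = algebraMap S B (f r)) (m : Ω[A⁄R]) :
        kaehlerMap f φ h (r • m) = f r • kaehlerMap f φ h m := by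
      rw [← algebraMap_smul A r m, map_smulₛₗ, h, algebraMap_smul]
    ext
    · exact key _ _ _
    · exact key _ _ _

end BaseChange
end Functoriality

/-! ## The Hodge bundle over the space of nonsingular forms -/

section Hodge

/-- The top exterior power `⋀^g H⁰(C_F, Ω¹_{C_F/R})`. -/
def HodgeLine {R : Type u} [CommRing R] {g : ℕ} (F : BinaryForm R (2 * g + 2)) : Type u :=
  ⋀[R]^g (globalDifferentials F)

instance {R : Type u} [CommRing R] {g : ℕ} (F : BinaryForm R (2 * g + 2)) :
    AddCommGroup (HodgeLine F) :=
  inferInstanceAs (AddCommGroup (⋀[R]^g (globalDifferentials F)))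

instance {R : Type u} [CommRing R] {g : ℕ} (F : BinaryForm R (2 * g + 2)) :
    Module R (HodgeLine F) :=
  inferInstanceAs (Module R (⋀[R]^g (globalDifferentials F)))

/-- The element `η₁ ∧ ⋯ ∧ η_g` of `⋀^g H⁰(C_F, Ω¹_{C_F/R})`. -/
def HodgeLine.wedge {R : Type u} [CommRing R] {g : ℕ} {F : BinaryForm R (2 * g + 2)}
    (η : Fin g → globalDifferentials F) : HodgeLine F :=
  exteriorPower.ιMulti R g η

/-- The tensor power `(⋀^g H⁰(C_F, Ω¹_{C_F/R}))^{⊗h}`. -/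
def HodgePower {R : Type u} [CommRing R] {g : ℕ} (F : BinaryForm R (2 * g + 2)) (h : ℕ) :
    Type u :=
  ⨂[R]^h (HodgeLine F)

instance {R : Type u} [CommRing R] {g : ℕ} (F : BinaryForm R (2 * g + 2)) (h : ℕ) :
    AddCommGroup (HodgePower F h) :=
  inferInstanceAs (AddCommGroup (⨂[R]^h (HodgeLine F)))

instance {R : Type u} [CommRing R] {g : ℕ} (F : BinaryForm R (2 * g + 2)) (h : ℕ) :
    Module R (HodgePower F h) :=
  inferInstanceAs (Module R (⨂[R]^h (HodgeLine F)))

/-- The tensor power `ω^{⊗h}`. -/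
def HodgeLine.tpow {R : Type u} [CommRing R] {g : ℕ} {F : BinaryForm R (2 * g + 2)}
    (ω : HodgeLine F) (h : ℕ) : HodgePower F h :=
  PiTensorProduct.tprod R fun _ : Fin h => ω

variable (k : Type u) [Field k] (g : ℕ)

/-- The discriminant as a polynomial over `k` in the coefficients of the form. -/
def universalDisc : MvPolynomial (Fin (2 * g + 2 + 1)) k :=
  BinaryForm.disc (d := 2 * g + 2) MvPolynomial.X

/-- The coordinate ring `k[a₀, …, a_d][1 / Disc]` of the affine variety `X_d⁰` of nonsingular
binary forms of degree `d = 2g + 2`, i.e. the ring of regular functions on `X_d⁰`. -/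
abbrev BaseRing : Type u := Localization.Away (universalDisc k g)

/-- The universal binary form over `X_d⁰`. The curve it defines is the universal hyperelliptic
curve `Y_d⁰ → X_d⁰`. As `X_d⁰` is affine, `globalDifferentials (universalForm k g)` is the module of
sections of `π_* Ω¹_{Y_d⁰/X_d⁰}`, `HodgeLine (universalForm k g)` is `Γ(X_d⁰, α)` and
`HodgePower (universalForm k g) h` is `Γ(X_d⁰, α^{⊗h})`, where `α` is the Hodge bundle. -/
def universalForm : BinaryForm (BaseRing k g) (2 * g + 2) := fun i =>
  algebraMap (MvPolynomial (Fin (2 * g + 2 + 1)) k) _ (MvPolynomial.X i)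

instance (h : ℕ) : Module k (HodgePower (universalForm k g) h) :=
  Module.compHom _ (algebraMap k (BaseRing k g))

/-- The nonsingular binary forms over a field `K`, i.e. the `K`-valued points of `X_d⁰`. -/
abbrev NonsingularForm (K : Type u) [Field K] (g : ℕ) : Type u :=
  {F : BinaryForm K (2 * g + 2) // F.disc ≠ 0}

variable {k g} {K : Type u} [Field K]

theorem aeval_universalDisc [Algebra k K] (F : BinaryForm K (2 * g + 2)) :
    MvPolynomial.aeval F (universalDisc k g) = F.disc := by
  unfold universalDisc BinaryForm.disc
  rw [← AlgHom.coe_toRingHom, MvPolynomial.aeval_def, MvPolynomial.hom_eval₂]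
  simp only [MvPolynomial.aeval_def, MvPolynomial.eval₂_eq']
  simp

/-- The value `Φ ↦ Φ(F)` of regular functions on `X_d⁰` at a nonsingular form `F`. -/
def evalAt [Algebra k K] (F : NonsingularForm K g) : BaseRing k g →ₐ[k] K :=
  IsLocalization.liftAlgHom (M := Submonoid.powers (universalDisc k g))
    (f := MvPolynomial.aeval F.1) (by
      rintro ⟨_, n, rfl⟩
      simpa [aeval_universalDisc] using fun h => absurd h F.2)

theorem evalAt_universalForm [Algebra k K] (F : NonsingularForm K g) (i : Fin (2 * g + 2 + 1)) :
    (evalAt F : BaseRing k g →ₐ[k] K).toRingHom (universalForm k g i) = F.1 i := by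
  simp [evalAt, universalForm]

/-- The value `s(F) ∈ ⋀^g H⁰(C_F, Ω¹)` of a section `s` of the Hodge bundle at a nonsingular form
`F`. -/
def HodgeLine.at (k : Type u) [Field k] [Algebra k K] (F : NonsingularForm K g) :
    HodgeLine (universalForm k g) →ₛₗ[(evalAt F : BaseRing k g →ₐ[k] K).toRingHom] HodgeLine F.1 :=
  extMap g (baseChange _ (universalForm k g) F.1 (evalAt_universalForm F))

/-- The value `s(F)` of a section `s` of `α^{⊗h}` at a nonsingular form `F`. -/
def HodgePower.at (k : Type u) [Field k] [Algebra k K] (h : ℕ) (F : NonsingularForm K g) :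
    HodgePower (universalForm k g) h →ₛₗ[(evalAt F : BaseRing k g →ₐ[k] K).toRingHom]
      HodgePower F.1 h :=
  tensorMap h (HodgeLine.at k F)

theorem HodgePower.at_smul [Algebra k K] (h : ℕ) (F : NonsingularForm K g) (c : k)
    (a : HodgePower (universalForm k g) h) :
    HodgePower.at k h F (c • a) = algebraMap k K c • HodgePower.at k h F a := by
  refine ((HodgePower.at k h F).map_smulₛₗ (algebraMap k (BaseRing k g) c) a).trans ?_
  exact congrArg (· • HodgePower.at k h F a) ((evalAt F).commutes c)

/-- The map `φ_u^* : α_{u·F} → α_F` on the fibres of the Hodge bundle. -/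
def HodgeLine.pullback (u : GL (Fin 2) K) (F F' : BinaryForm K (2 * g + 2)) (hF : F' = F.act u) :
    HodgeLine F' →ₗ[K] HodgeLine F :=
  exteriorPower.map g (pullbackAct u F F' hF)

/-- The map `φ_u^*` on the fibres of `α^{⊗h}`. -/
def HodgePower.pullback (h : ℕ) (u : GL (Fin 2) K) (F F' : BinaryForm K (2 * g + 2))
    (hF : F' = F.act u) : HodgePower F' h →ₗ[K] HodgePower F h :=
  PiTensorProduct.map fun _ => HodgeLine.pullback u F F' hF

variable (k g)

/-- The space `Inv_w(X_d⁰)` of invariants of degree `w` which are regular on `X_d⁰`: regular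
functions `Φ` on `X_d⁰` with `Φ(cF) = c^w Φ(F)` for nonzero scalars `c` and `Φ(u · F) = Φ(F)` for
`u` of determinant one, for points `F` and scalars and matrices over all extension fields of `k`.
(`X_d⁰` is stable under scalars and under `GL₂`, so `F'` ranges over all forms `cF` and `u · F`.) -/
def invariants (w : ℕ) : Submodule k (BaseRing k g) where
  carrier := {Φ | ∀ (K : Type u) [Field K] [Algebra k K] (F F' : NonsingularForm K g),
    (∀ c : K, c ≠ 0 → F'.1 = c • F.1 → evalAt F' Φ = c ^ w * evalAt F Φ) ∧
    (∀ u : GL (Fin 2) K, u.1.det = 1 → F'.1 = F.1.act u → evalAt F' Φ = evalAt F Φ)}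
  add_mem' := fun ha hb K _ _ F F' => ⟨fun c hc h => by
      rw [map_add, map_add, (ha K F F').1 c hc h, (hb K F F').1 c hc h, mul_add],
    fun u hu h => by rw [map_add, map_add, (ha K F F').2 u hu h, (hb K F F').2 u hu h]⟩
  zero_mem' := fun K _ _ F F' => by simp
  smul_mem' := fun c a ha K _ _ F F' => ⟨fun c hc h => by
      rw [map_smul, map_smul, (ha K F F').1 c hc h, mul_smul_comm],
    fun u hu h => by rw [map_smul, map_smul, (ha K F F').2 u hu h]⟩

/-- The space `Γ(X_d⁰, α^{⊗h})^G`, `G = GL₂`, of sections `s` of `α^{⊗h}` with `φ_u^* s = s`, that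
is, `φ_u^*(s(u · F)) = s(F)`, for all points `F` of `X_d⁰` and `u` of `G` over all extension fields
of `k`. -/
def invariantSections (h : ℕ) : Submodule k (HodgePower (universalForm k g) h) where
  carrier := {s | ∀ (K : Type u) [Field K] [Algebra k K] (F F' : NonsingularForm K g)
    (u : GL (Fin 2) K) (hF : F'.1 = F.1.act u),
    HodgePower.pullback h u F.1 F'.1 hF (HodgePower.at k h F' s) = HodgePower.at k h F s}
  add_mem' := fun {a b} ha hb K _ _ F F' u hF => by
    rw [(HodgePower.at k h F').map_add a b, (HodgePower.at k h F).map_add a b, map_add,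
      ha K F F' u hF, hb K F F' u hF]
  zero_mem' := fun K _ _ F F' u hF => by
    rw [(HodgePower.at k h F').map_zero, (HodgePower.at k h F).map_zero, map_zero]
  smul_mem' := fun c a ha K _ _ F F' u hF => by
    rw [HodgePower.at_smul, HodgePower.at_smul, map_smul, ha K F F' u hF]

/-- `η` is the global relative differential `x^i dx / y` on the universal hyperelliptic curve, that
is, `y η = x^i dx` on the chart `z = 1`. -/
def IsMonomialDifferential (i : ℕ) (η : globalDifferentials (universalForm k g)) : Prop :=
  chartY (universalForm k g) • η.1.1 =
    chartX (universalForm k g) ^ i • KaehlerDifferential.D (BaseRing k g) _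
      (chartX (universalForm k g))

end Hodge
end
end HyperellipticHodge

open HyperellipticHodge

/-!
The theorem comes from an explicit basis of the global differentials of `C_F : y² = F(x, z)`, over
any base ring in which `2` and the discriminant of `F` are invertible; this covers both the
universal curve and its fibres.

Let `f = F(x, 1)`. The vector of monomials, multiplied by the matrix whose determinant defines the
discriminant, shows that `f` and `f'` generate the unit ideal (`isCoprime_derivative`, and
`isCoprime_derivative_rev` for the chart at infinity). From `a f + b f' = 1` one gets the
differential `η = a y dx + 2 b dy` with `y η = dx`, and the vector field `y ∂/∂x + (f'/2) ∂/∂y`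
shows that `η` is a free generator (`exists_chartForm`). The generators of the two charts differ
by the factor `-x^(g-1)` on the overlap, so a pair of differentials `p η`, `q η'` glues exactly if
`p` is a polynomial in `x` of degree less than `g` (`exists_degree_lt_of_pull_eq`). Hence the
`x^i dx / y`, `i < g`, form a basis, and `ω^{⊗h}` generates the free module `Γ(X_d⁰, α^{⊗h})` of
rank one.

By the quotient rule, `φ_u^*(x^i dx / y) = det(u) (u₀₀ x + u₀₁)^i (u₁₀ x + u₁₁)^(g-1-i) dx / y`
(`pullbackAct_fst`). So `φ_u^*` has the matrix `det(u) Sym^(g-1)(u)`, whose determinant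
`det(u)^(g + g(g-1)/2) = det(u)^(dg/4)` is found by evaluation at `g` points, where it becomes a quotient of
two Vandermonde determinants (`det_symMatrix`).

A section is thus `Φ ω^{⊗h}` for a unique `Φ`, and it is invariant if and only if
`Φ(u · F) det(u)^(dgh/4) = Φ(F)`. Over an algebraically closed field a matrix is a scalar times a matrix of
determinant one, and a scalar `λ` acts on forms as `λ⁻ᵈ`; so this law says that `Φ` is an
invariant of degree `gh/2`. If `gh` is odd, the scalars with `λ^(d/2) = -1` force `Φ = 0`.
-/

namespace HyperellipticHodge
noncomputable section

/-! ### The discriminant and coprimality of `f` and `f'` -/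

section Discriminant
open Matrix

/-- At a common zero `(x : z)` of `p` and `q`, made homogeneous of degrees `m` and `n`, the vector
of monomials of degree `m + n - 1` is in the left kernel of the Sylvester matrix. -/
theorem vecMul_sylvester_map {U T : Type*} [CommRing U] [CommRing T] (φ : U →+* T) (p q : U[X])
    (m n : ℕ) (x z : T)
    (hp : ∀ j < n, x ^ j * z ^ (n - 1 - j) *
      ∑ i ∈ Finset.range (m + 1), φ (p.coeff i) * x ^ i * z ^ (m - i) = 0)
    (hq : ∀ j < m, x ^ j * z ^ (m - 1 - j) *
      ∑ i ∈ Finset.range (n + 1), φ (q.coeff i) * x ^ i * z ^ (n - i) = 0) :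
    (fun i : Fin (m + n) => x ^ (i : ℕ) * z ^ (m + n - 1 - i)) ᵥ*
      (p.sylvester q m n).map φ = 0 := by
  have key (r : U[X]) (a b j N : ℕ) (hj : j < b) (hN : N = a + b) : ∑ i : Fin N,
      (x ^ (i : ℕ) * z ^ (N - 1 - i)) *
        φ (if (i : ℕ) ∈ Set.Icc j (j + a) then r.coeff (i - j) else 0) =
      x ^ j * z ^ (b - 1 - j) *
        ∑ i ∈ Finset.range (a + 1), φ (r.coeff i) * x ^ i * z ^ (a - i) := by
    subst hN
    rw [Fin.sum_univ_eq_sum_range (fun i => (x ^ (i : ℕ) * z ^ (a + b - 1 - i)) *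
      φ (if (i : ℕ) ∈ Set.Icc j (j + a) then r.coeff (i - j) else 0)) (a + b), Finset.mul_sum]
    symm
    refine Finset.sum_of_injOn (fun i => j + i) (fun _ _ _ _ h => by simpa using h) ?_ ?_ ?_
    · intro i hi; simp at hi ⊢; omega
    · intro i _ hi
      have : i ∉ Set.Icc j (j + a) := by
        rintro ⟨h1, h2⟩
        exact hi ⟨i - j, by simp; omega, by simp; omega⟩
      simp [this]
    · intro i hi
      have hi' : i < a + 1 := by simpa using hi
      have h1 : j + i ∈ Set.Icc j (j + a) := ⟨by omega, by omega⟩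
      have h2 : a + b - 1 - (j + i) = (b - 1 - j) + (a - i) := by omega
      simp only [h1, if_true, h2, pow_add, Nat.add_sub_cancel_left]
      ring
  funext j
  rw [vecMul, dotProduct, Pi.zero_apply]
  refine j.addCases (fun j => ?_) (fun j => ?_)
  · simp only [sylvester, map_apply, of_apply, Fin.addCases_left]
    rw [key q n m j _ j.2 (add_comm _ _), hq j j.2]
  · simp only [sylvester, map_apply, of_apply, Fin.addCases_right]
    rw [key p m n j _ j.2 rfl, hp j j.2]

variable {R T : Type*} [CommRing R] [CommRing T] {d : ℕ}

/-- The universal inhomogeneous polynomial `∑ aᵢ xⁱ`. -/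
def universalPoly (d : ℕ) : (MvPolynomial (Fin (d + 1)) ℤ)[X] :=
  ∑ i : Fin (d + 1), C (MvPolynomial.X i) * X ^ (i : ℕ)

theorem coeff_universalPoly (i : Fin (d + 1)) :
    (universalPoly d).coeff i = MvPolynomial.X i := by
  simp [universalPoly, coeff_X_pow, Fin.val_inj]

theorem natDegree_universalPoly : (universalPoly d).natDegree = d := by
  refine natDegree_eq_of_le_of_coeff_ne_zero ?_ ?_
  · refine natDegree_sum_le_of_forall_le _ _ fun i _ => ?_
    exact (natDegree_C_mul_X_pow_le _ _).trans (Nat.lt_succ_iff.1 i.2)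
  · have := coeff_universalPoly (Fin.last d)
    rw [Fin.val_last] at this
    rw [this]
    exact MvPolynomial.X_ne_zero _

theorem map_universalPoly (F : BinaryForm T d) :
    (universalPoly d).map (MvPolynomial.aeval F : _ →ₐ[ℤ] T).toRingHom = F.eval X 1 := by
  simp [universalPoly, BinaryForm.eval, Polynomial.map_sum]

theorem coeff_eval_X_one (F : BinaryForm T d) (i : Fin (d + 1)) :
    (F.eval X 1 : T[X]).coeff i = F i := by
  rw [← map_universalPoly, coeff_map, coeff_universalPoly]; simp

theorem natDegree_eval_X_one_le (F : BinaryForm T d) : (F.eval X 1 : T[X]).natDegree ≤ d := by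
  rw [← map_universalPoly]
  exact natDegree_map_le.trans natDegree_universalPoly.le

theorem disc_map (φ : R →+* T) (F : BinaryForm R d) (F' : BinaryForm T d)
    (hF : ∀ i, φ (F i) = F' i) : φ F.disc = F'.disc := by
  have : F' = fun i => φ (F i) := funext fun i => (hF i).symm
  subst this
  unfold BinaryForm.disc
  rw [MvPolynomial.aeval_def, MvPolynomial.aeval_def, MvPolynomial.hom_eval₂]
  congr 1
  exact RingHom.ext_int _ _

/-- At a common zero of `F` and `∂F/∂x`, the discriminant kills all monomials of degree `2d - 2`
in the coordinates apart from the power of `x`. -/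
theorem disc_mul_monomial_eq_zero (hd : 2 ≤ d) (F : BinaryForm T d) (x z : T)
    (h0 : ∑ i : Fin (d + 1), F i * x ^ (i : ℕ) * z ^ (d - i) = 0)
    (h1 : ∑ i ∈ Finset.range d,
      (F.eval X 1 : T[X]).derivative.coeff i * x ^ i * z ^ (d - 1 - i) = 0)
    {i : ℕ} (hi : i < 2 * d - 2) : F.disc * (x ^ i * z ^ (2 * d - 2 - i)) = 0 := by
  set φ : MvPolynomial (Fin (d + 1)) ℤ →+* T := (MvPolynomial.aeval F : _ →ₐ[ℤ] T).toRingHom with hφ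
  set f := universalPoly d
  have hn : f.natDegree = d := natDegree_universalPoly
  have hc (i : Fin (d + 1)) : φ (f.coeff i) = F i := by
    rw [coeff_universalPoly]; simp [hφ]
  let v : Fin (f.natDegree - 1 + f.natDegree) → T := fun i =>
    x ^ (i : ℕ) * z ^ (f.natDegree - 1 + f.natDegree - 1 - i)
  let l : Fin (f.natDegree - 1 + f.natDegree) := ⟨2 * f.natDegree - 2, by lia⟩
  have hv : v ᵥ* (f.derivative.sylvester f (f.natDegree - 1) f.natDegree).map φ = 0 := by
    apply vecMul_sylvester_map
    · intro j _
      rw [hn, Nat.sub_add_cancel (by omega)]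
      convert mul_zero _ using 2
      rw [← h1]
      refine Finset.sum_congr rfl fun i _ => ?_
      rw [← map_universalPoly, derivative_map, coeff_map]
    · intro j _
      rw [hn]
      convert mul_zero _ using 2
      rw [← h0, Finset.sum_range]
      exact Finset.sum_congr rfl fun i _ => by rw [hc]
  -- The modified Sylvester matrix has its last row divided by the leading coefficient, which is
  -- undone by multiplying the last entry of the vector by that coefficient.
  let v' := Function.update v l (F (Fin.last d) * v l)
  let M := f.sylvesterDeriv.map φ
  have hlc : φ f.leadingCoeff = F (Fin.last d) := by
    rw [leadingCoeff, hn]; exact hc (Fin.last d)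
  have hv' : v' ᵥ* M = 0 := by
    rw [← hv, ← sylvesterDeriv_updateRow f (by omega)]
    funext j
    simp only [vecMul, dotProduct]
    refine Finset.sum_congr rfl fun i _ => ?_
    by_cases hi : i = l
    · subst hi
      simp only [v', M, Function.update_self, map_apply, l, updateRow_self, Pi.smul_apply,
        smul_eq_mul, map_mul, hlc]
      ring
    · have : (f.sylvesterDeriv.updateRow ⟨2 * f.natDegree - 2, by lia⟩
          (f.leadingCoeff • (f.sylvesterDeriv ⟨2 * f.natDegree - 2, by lia⟩))) i =
            f.sylvesterDeriv i := updateRow_ne hi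
      simp only [v', M, Function.update_of_ne hi, map_apply, this]
  have hdet : ∀ i, M.det * v' i = 0 := by
    intro i
    have := congrArg (· ᵥ* M.adjugate) hv'
    simp only [vecMul_vecMul, mul_adjugate, zero_vecMul, vecMul_smul, vecMul_one] at this
    exact congrFun this i
  have hdisc : F.disc = M.det * (-1) ^ (f.natDegree * (f.natDegree - 1) / 2) := by
    change φ (f.discr) = _
    rw [Polynomial.discr, map_mul, map_pow, map_neg, map_one, RingHom.map_det]
    rfl
  have hdet' : ∀ i, F.disc * v' i = 0 := by
    intro i; rw [hdisc, mul_right_comm, hdet, zero_mul]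
  have := hdet' ⟨i, by omega⟩
  have hne : (⟨i, by omega⟩ : Fin (f.natDegree - 1 + f.natDegree)) ≠ l := by
    rw [Ne, Fin.ext_iff]; simp only [l]; omega
  simp only [v', Function.update_of_ne hne, v] at this
  convert this using 4
  omega

/-- A form divisible by `z²` has discriminant zero. -/
theorem disc_eq_zero_of_top (hd : 2 ≤ d) (F : BinaryForm T d) (h0 : F (Fin.last d) = 0)
    (h1 : F ⟨d - 1, by omega⟩ = 0) : F.disc = 0 := by
  set φ : MvPolynomial (Fin (d + 1)) ℤ →+* T := (MvPolynomial.aeval F : _ →ₐ[ℤ] T).toRingHom with hφ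
  set f := universalPoly d
  have hn : f.natDegree = d := natDegree_universalPoly
  have hc (i : ℕ) (hi : d - 1 ≤ i) : φ (f.coeff i) = 0 := by
    rcases lt_trichotomy i d with h | rfl | h
    · have := coeff_universalPoly (d := d) ⟨i, by omega⟩
      have hi' : i = d - 1 := by omega
      subst hi'
      rw [this, ← h1]; simp [hφ]
    · have := coeff_universalPoly (Fin.last i)
      rw [Fin.val_last] at this
      rw [this, ← h0]; simp [hφ]
    · rw [coeff_eq_zero_of_natDegree_lt (by omega), map_zero]
  have hdet : (f.sylvesterDeriv.map φ).det = 0 := by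
    apply det_eq_zero_of_row_eq_zero ⟨2 * f.natDegree - 3, by omega⟩
    intro j
    rw [sylvesterDeriv, dif_neg (by omega), map_apply,
      updateRow_ne (by rw [Ne, Fin.ext_iff]; simp only; omega)]
    refine j.addCases (fun j => ?_) (fun j => ?_)
    · have := j.2
      simp only [sylvester, of_apply, Fin.addCases_left]
      split_ifs with h
      · rw [hc _ (by omega)]
      · simp
    · have := j.2
      simp only [sylvester, of_apply, Fin.addCases_right]
      split_ifs with h
      · rw [coeff_derivative, map_mul, hc _ (by omega), zero_mul]
      · simp
  change φ f.discr = _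
  rw [Polynomial.discr, map_mul, RingHom.map_det, RingHom.mapMatrix_apply, hdet, zero_mul]

theorem eval_X_one_map (φ : R →+* T) (F : BinaryForm R d) :
    (BinaryForm.eval (fun i => φ (F i) : BinaryForm T d) X 1 : T[X]) =
      (F.eval X 1 : R[X]).map φ := by
  simp [BinaryForm.eval, Polynomial.map_sum]

theorem eval_eq_sum_range (F : BinaryForm T d) (x z : T) :
    (F.eval x z : T) =
      ∑ i ∈ Finset.range (d + 1), (F.eval X 1 : T[X]).coeff i * x ^ i * z ^ (d - i) := by
  rw [BinaryForm.eval, Finset.sum_range]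
  exact Finset.sum_congr rfl fun i _ => by rw [coeff_eval_X_one]; rfl

theorem eval_derivative_eq_sum_range (F : BinaryForm T d) (x : T) :
    (F.eval X 1 : T[X]).derivative.eval x =
      ∑ i ∈ Finset.range d, (F.eval X 1 : T[X]).coeff (i + 1) * (i + 1) * x ^ i := by
  have h := natDegree_eval_X_one_le F
  rcases d with _ | d
  · have : (F.eval X 1 : T[X]).natDegree = 0 := by omega
    rw [derivative_of_natDegree_zero this]; simp
  · rw [eval_eq_sum_range' (n := d + 1)]
    · simp only [coeff_derivative]
    · have := natDegree_derivative_le (F.eval X 1 : T[X])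
      omega

/-- A form and its derivative generate the unit ideal when the discriminant is invertible. -/
theorem isCoprime_derivative (hd : 2 ≤ d) (F : BinaryForm R d) (hF : IsUnit F.disc) :
    IsCoprime (F.eval X 1 : R[X]) (F.eval X 1 : R[X]).derivative := by
  set f := (F.eval X 1 : R[X]) with hf
  rw [← Ideal.isCoprime_span_singleton_iff, Ideal.isCoprime_iff_sup_eq, ← Ideal.span_insert]
  let π : R[X] →+* R[X] ⧸ Ideal.span {f, f.derivative} := Ideal.Quotient.mk _
  have hπ (p : R[X]) : (p.map (π.comp C)).eval (π X) = π p := by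
    rw [Polynomial.eval_map, ← hom_eval₂, eval₂_C_X]
  let G : BinaryForm (R[X] ⧸ Ideal.span {f, f.derivative}) d := fun i => (π.comp C) (F i)
  have hG : (G.eval X 1 : Polynomial _) = f.map (π.comp C) := eval_X_one_map _ F
  have h0 : (G.eval (π X) 1 : R[X] ⧸ Ideal.span {f, f.derivative}) = 0 := by
    have : π f = 0 := Ideal.Quotient.eq_zero_iff_mem.2 (Ideal.subset_span (by simp))
    rw [← this, ← hπ f, ← hG, eval_eq_sum_range, Polynomial.eval_eq_sum_range' (n := d + 1)
      (Nat.lt_succ_iff.2 (natDegree_eval_X_one_le G))]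
    simp
  have h1 : (G.eval X 1 : Polynomial _).derivative.eval (π X) = 0 := by
    have : π f.derivative = 0 := Ideal.Quotient.eq_zero_iff_mem.2 (Ideal.subset_span (by simp))
    rw [← this, ← hπ f.derivative, hG, derivative_map]
  have key := disc_mul_monomial_eq_zero hd G (π X) 1 h0 (by
    rw [eval_derivative_eq_sum_range] at h1
    rw [← h1]
    exact Finset.sum_congr rfl fun i _ => by rw [coeff_derivative]; simp) (i := 0) (by omega)
  have hu : IsUnit G.disc := by
    rw [← disc_map (π.comp C) F G fun _ => rfl]; exact hF.map _
  have : (1 : R[X] ⧸ Ideal.span {f, f.derivative}) = 0 := by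
    simpa using hu.mul_right_eq_zero.1 key
  rw [Ideal.eq_top_iff_one, ← Ideal.Quotient.eq_zero_iff_mem]
  exact this

/-- Euler's identity `x ∂F/∂x + z ∂F/∂z = d F` at `x = 1`. -/
theorem euler_identity (F : BinaryForm T d) (t : T) :
    ∑ i ∈ Finset.range d, (F.eval X 1 : T[X]).derivative.coeff i * t ^ (d - 1 - i) =
      d * (F.rev.eval X 1 : T[X]).eval t - t * (F.rev.eval X 1 : T[X]).derivative.eval t := by
  have hrev : ∀ i ≤ d, (F.rev.eval X 1 : T[X]).coeff i = (F.eval X 1 : T[X]).coeff (d - i) := by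
    intro i hi
    have h1 := coeff_eval_X_one F.rev ⟨i, by omega⟩
    have h2 := coeff_eval_X_one F ⟨d - i, by omega⟩
    simp only at h1 h2
    rw [h1, h2, BinaryForm.rev]
    congr 1
    rw [Fin.ext_iff, Fin.val_rev]; simp only; omega
  set a := (F.eval X 1 : T[X]).coeff
  have e1 : ∑ i ∈ Finset.range d, (F.eval X 1 : T[X]).derivative.coeff i * t ^ (d - 1 - i) =
      ∑ i ∈ Finset.range (d + 1), i * a i * t ^ (d - i) := by
    rw [Finset.sum_range_succ']
    simp only [Nat.cast_zero, zero_mul, add_zero]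
    refine Finset.sum_congr rfl fun i _ => ?_
    rw [coeff_derivative, show d - 1 - i = d - (i + 1) by omega]
    push_cast; ring
  have e2 : t * (F.rev.eval X 1 : T[X]).derivative.eval t =
      ∑ i ∈ Finset.range (d + 1), (d - i : T) * a i * t ^ (d - i) := by
    rw [← Finset.sum_range_reflect, Finset.sum_range_succ', eval_derivative_eq_sum_range,
      Finset.mul_sum]
    have : ((d : T) - ((d + 1 - 1 - 0 : ℕ) : T)) = 0 := by simp
    rw [this]
    simp only [zero_mul, add_zero]
    refine Finset.sum_congr rfl fun i hi => ?_
    have hi : i < d := by simpa using hi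
    rw [hrev _ (by omega), show d + 1 - 1 - (i + 1) = d - (i + 1) by omega,
      Nat.cast_sub (by omega), show d - (d - (i + 1)) = i + 1 by omega]
    push_cast; ring
  have e3 : (F.rev.eval X 1 : T[X]).eval t = ∑ i ∈ Finset.range (d + 1), a i * t ^ (d - i) := by
    rw [Polynomial.eval_eq_sum_range' (n := d + 1)
      (Nat.lt_succ_iff.2 (natDegree_eval_X_one_le _)), ← Finset.sum_range_reflect]
    refine Finset.sum_congr rfl fun i hi => ?_
    have hi : i < d + 1 := by simpa using hi
    rw [hrev _ (by omega), show d + 1 - 1 - i = d - i by omega, show d - (d - i) = i by omega]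
  rw [e1, e2, e3, Finset.mul_sum, ← Finset.sum_sub_distrib]
  exact Finset.sum_congr rfl fun i _ => by ring

/-- The form `F(z, x)` is coprime to its derivative as well. Modulo the two, Euler's identity and
`disc_mul_monomial_eq_zero` at the point `(1 : z)` give `z = 0`, and then `F(x, z)` becomes
divisible by `z²`. -/
theorem isCoprime_derivative_rev (hd : 2 ≤ d) (F : BinaryForm R d) (hF : IsUnit F.disc) :
    IsCoprime (F.rev.eval X 1 : R[X]) (F.rev.eval X 1 : R[X]).derivative := by
  set f := (F.rev.eval X 1 : R[X]) with hf
  rw [← Ideal.isCoprime_span_singleton_iff, Ideal.isCoprime_iff_sup_eq, ← Ideal.span_insert]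
  set Q := R[X] ⧸ Ideal.span {f, f.derivative} with hQ
  let π : R[X] →+* Q := Ideal.Quotient.mk _
  have hπ (p : R[X]) : (p.map (π.comp C)).eval (π X) = π p := by
    rw [Polynomial.eval_map, ← hom_eval₂, eval₂_C_X]
  set t := π X
  let G : BinaryForm Q d := fun i => (π.comp C) (F i)
  have hG : (G.rev.eval X 1 : Q[X]) = f.map (π.comp C) := eval_X_one_map _ F.rev
  have h0 : (G.rev.eval X 1 : Q[X]).eval t = 0 := by
    rw [hG, hπ]
    exact Ideal.Quotient.eq_zero_iff_mem.2 (Ideal.subset_span (by simp))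
  have h1 : (G.rev.eval X 1 : Q[X]).derivative.eval t = 0 := by
    rw [hG, derivative_map, hπ]
    exact Ideal.Quotient.eq_zero_iff_mem.2 (Ideal.subset_span (by simp))
  have h0' : (G.eval 1 t : Q) = 0 := by
    rw [← G.eval_rev, ← h0, eval_eq_sum_range, Polynomial.eval_eq_sum_range' (n := d + 1)
      (Nat.lt_succ_iff.2 (natDegree_eval_X_one_le G.rev))]
    simp
  have key := disc_mul_monomial_eq_zero hd G 1 t h0' (by
    have := euler_identity G t
    rw [h0, h1, mul_zero, mul_zero, sub_zero] at this
    simpa using this) (i := 2 * d - 3) (by omega)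
  rw [one_pow, one_mul, show 2 * d - 2 - (2 * d - 3) = 1 by omega, pow_one] at key
  have hu : IsUnit G.disc := by
    rw [← disc_map (π.comp C) F G fun _ => rfl]; exact hF.map _
  have ht : t = 0 := hu.mul_right_eq_zero.1 key
  rw [ht] at h0 h1
  rw [← coeff_zero_eq_eval_zero] at h0 h1
  rw [coeff_derivative] at h1
  have c0 := coeff_eval_X_one G.rev 0
  have c1 := coeff_eval_X_one G.rev ⟨1, by omega⟩
  have hdisc : G.disc = 0 := by
    apply disc_eq_zero_of_top hd
    · rw [← h0]
      simp only [Fin.val_zero] at c0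
      rw [c0]; simp [BinaryForm.rev]
    · simp only [zero_add, Nat.cast_zero, mul_one] at c1 h1
      rw [← h1, c1, BinaryForm.rev]
      congr 1
  have : (1 : Q) = 0 := by
    rw [hdisc, isUnit_zero_iff] at hu
    exact hu.symm
  rw [Ideal.eq_top_iff_one, ← Ideal.Quotient.eq_zero_iff_mem]
  exact this

/-- A form with invertible discriminant has unit content, so it is not a zero divisor. -/
theorem eval_X_one_mem_nonZeroDivisors (hd : 2 ≤ d) (F : BinaryForm R d) (hF : IsUnit F.disc) :
    (F.eval X 1 : R[X]) ∈ nonZeroDivisors R[X] := by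
  by_contra h
  obtain ⟨a, ha, haf⟩ := Polynomial.notMem_nonZeroDivisors_iff.1 h
  obtain ⟨p, q, hpq⟩ := isCoprime_derivative hd F hF
  apply ha
  have h2 : a • (F.eval X 1 : R[X]).derivative = 0 := by
    rw [← derivative_smul, haf, derivative_zero]
  have : a • (1 : R[X]) = 0 := by
    rw [← hpq, smul_add, ← mul_smul_comm, ← mul_smul_comm, haf, h2, mul_zero, mul_zero, add_zero]
  simpa using congrArg (coeff · 0) this

theorem resultant_eval_X_one (F : BinaryForm T d) (hd : 2 ≤ d) :
    (F.eval X 1 : T[X]).resultant (F.eval X 1 : T[X]).derivative d (d - 1) =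
      (-1) ^ (d * (d - 1) / 2) * F (Fin.last d) * F.disc := by
  have hn : (universalPoly d).natDegree = d := natDegree_universalPoly
  have h := resultant_deriv (f := universalPoly d)
    (natDegree_pos_iff_degree_pos.1 (by omega))
  have h2 := congrArg (MvPolynomial.aeval F : _ →ₐ[ℤ] T).toRingHom h
  rw [hn, ← resultant_map_map, ← derivative_map, map_universalPoly] at h2
  rw [h2, map_mul, map_mul, map_pow, map_neg, map_one, leadingCoeff, hn]
  congr 2
  have := coeff_universalPoly (Fin.last d)
  rw [Fin.val_last] at this
  rw [this]; simp

theorem disc_smul (hd : 2 ≤ d) (c : T) (F : BinaryForm T d) :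
    (c • F).disc = c ^ (2 * d - 2) * F.disc := by
  -- By specialization it suffices to treat the universal form and an indeterminate scalar, where
  -- the leading coefficient and the scalar can be cancelled.
  let V := MvPolynomial (Option (Fin (d + 1))) ℤ
  let G : BinaryForm V d := fun i => MvPolynomial.X (some i)
  let s : V := MvPolynomial.X none
  have key : (s • G).disc = s ^ (2 * d - 2) * G.disc := by
    have h1 := resultant_eval_X_one G hd
    have h2 := resultant_eval_X_one (s • G) hd
    have e : ((s • G).eval X 1 : V[X]) = C s * G.eval X 1 := by
      simp only [BinaryForm.eval, Finset.mul_sum, Pi.smul_apply, smul_eq_mul, map_mul]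
      exact Finset.sum_congr rfl fun i _ => by rw [← C_eq_algebraMap]; ring
    rw [e, derivative_C_mul, resultant_C_mul_left, resultant_C_mul_right, h1] at h2
    have hG : G (Fin.last d) ≠ 0 := MvPolynomial.X_ne_zero _
    have hs : s ≠ 0 := MvPolynomial.X_ne_zero _
    have hne : ((-1) ^ (d * (d - 1) / 2) * G (Fin.last d) * s : V) ≠ 0 :=
      mul_ne_zero (mul_ne_zero (pow_ne_zero _ (by simp)) hG) hs
    apply mul_left_cancel₀ hne
    rw [Pi.smul_apply, smul_eq_mul] at h2
    have e2 : s * s ^ (2 * d - 2) = s ^ (d - 1) * s ^ d := by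
      rw [← pow_succ', ← pow_add]; congr 1; omega
    linear_combination -h2 - (-1) ^ (d * (d - 1) / 2) * G (Fin.last d) * G.disc * e2
  let φ : V →+* T :=
    (MvPolynomial.aeval (fun o : Option (Fin (d + 1)) => o.elim c F) : _ →ₐ[ℤ] T).toRingHom
  have hs : φ s = c := MvPolynomial.aeval_X _ _
  have hG (i) : φ (G i) = F i := MvPolynomial.aeval_X _ _
  have := congrArg φ key
  rw [disc_map φ (s • G) (c • F) (fun i => by simp [hs, hG]), map_mul, map_pow, hs,
    disc_map φ G F hG] at this
  exact this

end Discriminant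

/-! ### Differentials on a chart -/

section Coordinates
variable {R : Type*} [CommRing R] {d : ℕ} (F : BinaryForm R d)

theorem of_eq_aeval (p : R[X]) :
    AdjoinRoot.of (X ^ 2 - C (F.eval X 1) : R[X][X]) p = aeval (chartX F) p := by
  have : (AdjoinRoot.ofAlgHom R (X ^ 2 - C (F.eval X 1) : R[X][X])) = aeval (chartX F) :=
    Polynomial.algHom_ext (by simp [chartX])
  exact congrArg (fun φ : R[X] →ₐ[R] ChartRing F => φ p) this

theorem chartY_sq_aeval : chartY F ^ 2 = aeval (chartX F) (F.eval X 1 : R[X]) := by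
  rw [chartY_sq, BinaryForm.map_eval]; simp

/-- The functions `1` and `y` span the coordinate ring of the chart over `R[x]`. -/
theorem exists_coord (a : ChartRing F) :
    ∃ p q : R[X], a = aeval (chartX F) p + aeval (chartX F) q * chartY F := by
  obtain ⟨P, rfl⟩ := AdjoinRoot.mk_surjective a
  induction P using Polynomial.induction_on' with
  | add P Q hP hQ =>
    obtain ⟨p, q, h⟩ := hP
    obtain ⟨p', q', h'⟩ := hQ
    exact ⟨p + p', q + q', by rw [map_add, h, h', map_add, map_add]; ring⟩
  | monomial n p =>
    have e : AdjoinRoot.mk (X ^ 2 - C (F.eval X 1) : R[X][X]) (monomial n p) =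
        aeval (chartX F) p * chartY F ^ n := by
      rw [← C_mul_X_pow_eq_monomial, map_mul, map_pow, AdjoinRoot.mk_C, AdjoinRoot.mk_X,
        of_eq_aeval]
      rfl
    rw [e]
    obtain ⟨k, rfl | rfl⟩ := n.even_or_odd'
    · refine ⟨p * (F.eval X 1) ^ k, 0, ?_⟩
      rw [pow_mul, chartY_sq_aeval]; simp
    · refine ⟨0, p * (F.eval X 1) ^ k, ?_⟩
      rw [pow_succ (chartY F), pow_mul, chartY_sq_aeval]; simp; ring

/-- The functions `1` and `y` are linearly independent over `R[x]`. -/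
theorem coord_eq_zero {p q : R[X]} (h : aeval (chartX F) p + aeval (chartX F) q * chartY F = 0) :
    p = 0 ∧ q = 0 := by
  nontriviality R
  have hm : (X ^ 2 - C (F.eval X 1) : R[X][X]).Monic := monic_X_pow_sub_C _ two_ne_zero
  have hdvd : (X ^ 2 - C (F.eval X 1) : R[X][X]) ∣ C q * X + C p := by
    rw [← AdjoinRoot.mk_eq_zero, ← h, map_add, map_mul, AdjoinRoot.mk_C, AdjoinRoot.mk_C,
      AdjoinRoot.mk_X, of_eq_aeval, of_eq_aeval, add_comm]
    rfl
  have h0 : (C q * X + C p : R[X][X]) = 0 := by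
    by_contra hne
    refine hm.not_dvd_of_natDegree_lt hne ?_ hdvd
    rw [natDegree_X_pow_sub_C]
    exact natDegree_linear_le.trans_lt one_lt_two
  exact ⟨by simpa using congrArg (coeff · 0) h0, by simpa using congrArg (coeff · 1) h0⟩

theorem aeval_chartX_injective : Function.Injective (aeval (R := R) (chartX F)) := by
  rw [injective_iff_map_eq_zero]
  intro p hp
  exact (coord_eq_zero F (p := p) (q := 0) (by simp [hp])).1

theorem aeval_chartX_mem_nonZeroDivisors {p : R[X]} (hp : p ∈ nonZeroDivisors R[X]) :
    aeval (chartX F) p ∈ nonZeroDivisors (ChartRing F) := by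
  rw [mem_nonZeroDivisors_iff_right]
  intro a ha
  obtain ⟨q, r, rfl⟩ := exists_coord F a
  have := coord_eq_zero F (p := q * p) (q := r * p) (by rw [← ha, map_mul, map_mul]; ring)
  rw [mem_nonZeroDivisors_iff_right] at hp
  rw [hp _ this.1, hp _ this.2]; simp

theorem chartX_pow_mem_nonZeroDivisors (n : ℕ) :
    chartX F ^ n ∈ nonZeroDivisors (ChartRing F) := by
  have := aeval_chartX_mem_nonZeroDivisors F (p := X ^ n) (monic_X_pow n).mem_nonZeroDivisors
  simpa using this

theorem chartY_mem_nonZeroDivisors (hF : (F.eval X 1 : R[X]) ∈ nonZeroDivisors R[X]) :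
    chartY F ∈ nonZeroDivisors (ChartRing F) := by
  have := aeval_chartX_mem_nonZeroDivisors F hF
  rw [← chartY_sq_aeval, pow_two (chartY F)] at this
  exact (mul_mem_nonZeroDivisors.1 this).1

end Coordinates

section Generator
variable {R : Type u} [CommRing R] {d : ℕ} (F : BinaryForm R d)

/-- The `R`-algebra map `A → A[ε]` given by the vector field `y ∂/∂x + (f'/2) ∂/∂y`. -/
theorem exists_dual_lift (c : R) (hc : 2 * c = 1) :
    ∃ χ : ChartRing F →ₐ[R] TrivSqZeroExt (ChartRing F) (ChartRing F),
      χ (chartX F) = .inl (chartX F) + .inr (chartY F) ∧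
      χ (chartY F) = .inl (chartY F) +
        .inr (c • aeval (chartX F) (F.eval X 1 : R[X]).derivative) := by
  set x := chartX F
  set y := chartY F
  set f := (F.eval X 1 : R[X])
  have h : (.inl y + .inr (c • aeval x f.derivative) :
      TrivSqZeroExt (ChartRing F) (ChartRing F)) ^ 2 = F.eval (.inl x + .inr y) 1 := by
    have e1 : (F.eval (.inl x + .inr y) 1 : TrivSqZeroExt (ChartRing F) (ChartRing F)) =
        aeval (.inl x + .inr y : TrivSqZeroExt (ChartRing F) (ChartRing F)) f := by
      rw [BinaryForm.map_eval]; simp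
    have e2 (p : R[X]) : aeval (.inl x : TrivSqZeroExt (ChartRing F) (ChartRing F)) p =
        .inl (aeval x p) := by
      have := aeval_algHom_apply (TrivSqZeroExt.inlAlgHom R (ChartRing F) (ChartRing F)) x p
      simpa using this
    rw [e1, aeval_add_of_sq_eq_zero _ _ _ (by rw [pow_two, TrivSqZeroExt.inr_mul_inr]), e2, e2,
      ← chartY_sq_aeval]
    have e3 : y * (c • aeval x f.derivative) + y * (c • aeval x f.derivative) =
        aeval x f.derivative * y := by
      rw [← two_mul, mul_smul_comm, mul_smul_comm]
      have : (c • (2 * (y * aeval x f.derivative)) : ChartRing F) =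
        (2 * c) • (aeval x f.derivative * y) := by
        rw [two_mul, smul_add, two_mul, add_smul, mul_comm y]
      rw [this, hc, one_smul]
    ext
    · simp [pow_two, y]
    · simp only [pow_two, TrivSqZeroExt.snd_mul, TrivSqZeroExt.fst_add, TrivSqZeroExt.snd_add,
        TrivSqZeroExt.fst_inl, TrivSqZeroExt.snd_inl, TrivSqZeroExt.fst_inr, TrivSqZeroExt.snd_inr,
        add_zero, zero_add, smul_eq_mul, op_smul_eq_smul, smul_zero]
      linear_combination e3
  exact ⟨chartHom F _ _ h, chartHom_X F _ _ h, chartHom_Y F _ _ h⟩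

/-- The `A`-linear form `dx ↦ y`, `dy ↦ f'/2` on the differentials of the chart. -/
theorem exists_dual_form (c : R) (hc : 2 * c = 1) :
    ∃ ρ : Ω[ChartRing F⁄R] →ₗ[ChartRing F] ChartRing F,
      ρ (KaehlerDifferential.D R _ (chartX F)) = chartY F ∧
      ρ (KaehlerDifferential.D R _ (chartY F)) =
        c • aeval (chartX F) (F.eval X 1 : R[X]).derivative := by
  obtain ⟨χ, hx, hy⟩ := exists_dual_lift F c hc
  have hfst : ∀ a, (χ a).fst = a := by
    have : (TrivSqZeroExt.fstHom R (ChartRing F) (ChartRing F)).comp χ = AlgHom.id R _ := by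
      apply chart_ext <;> simp [hx, hy]
    exact fun a => congrArg (fun φ : ChartRing F →ₐ[R] ChartRing F => φ a) this
  let δ : Derivation R (ChartRing F) (ChartRing F) := Derivation.mk'
    ((TrivSqZeroExt.sndHom (ChartRing F) (ChartRing F)).restrictScalars R ∘ₗ χ.toLinearMap)
    (fun a b => by
      change (χ (a * b)).snd = a • (χ b).snd + b • (χ a).snd
      rw [map_mul, TrivSqZeroExt.snd_mul, hfst, hfst, op_smul_eq_smul])
  refine ⟨δ.liftKaehlerDifferential, ?_, ?_⟩
  · rw [Derivation.liftKaehlerDifferential_comp_D]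
    change (χ (chartX F)).snd = _
    simp [hx]
  · rw [Derivation.liftKaehlerDifferential_comp_D]
    change (χ (chartY F)).snd = _
    simp [hy]

theorem two_smul_chartY_D : (2 * chartY F) • KaehlerDifferential.D R _ (chartY F) =
    aeval (chartX F) (F.eval X 1 : R[X]).derivative • KaehlerDifferential.D R _ (chartX F) := by
  have h := congrArg (KaehlerDifferential.D R (ChartRing F)) (chartY_sq_aeval F)
  rw [Derivation.leibniz_pow, Derivation.map_aeval] at h
  rw [← h]
  simp [two_smul, two_mul, add_smul]

/-- On a smooth chart the differentials are free of rank one, generated by `η = dx / y`, which is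
obtained as `a y dx + 2 b dy` from a relation `a f + b f' = 1`. -/
theorem exists_chartForm (h2 : IsUnit (2 : R))
    (hF : IsCoprime (F.eval X 1 : R[X]) (F.eval X 1 : R[X]).derivative) :
    ∃ η : Ω[ChartRing F⁄R], chartY F • η = KaehlerDifferential.D R _ (chartX F) ∧
      Function.Bijective (fun a : ChartRing F => a • η) := by
  obtain ⟨c, hc⟩ := h2.exists_right_inv
  obtain ⟨a, b, hab⟩ := hF
  obtain ⟨ρ, hx, hy⟩ := exists_dual_form F c hc
  have hD := two_smul_chartY_D F
  have hY := chartY_sq_aeval F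
  set x := chartX F
  set y := chartY F
  set D := KaehlerDifferential.D R (ChartRing F)
  set f := (F.eval X 1 : R[X])
  have hab' : aeval x a * aeval x f + aeval x b * aeval x f.derivative = 1 := by
    rw [← map_mul, ← map_mul, ← map_add, hab, map_one]
  have hc' : 2 * algebraMap R (ChartRing F) c = 1 := by
    have := congrArg (algebraMap R (ChartRing F)) hc
    rwa [map_mul, map_one, map_ofNat] at this
  let η : Ω[ChartRing F⁄R] := (aeval x a * y) • D x + (2 * aeval x b) • D y
  have h1 : y • η = D x := by
    calc y • η = (aeval x a * y ^ 2) • D x + aeval x b • (2 * y) • D y := by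
          simp only [η]; module
      _ = (aeval x a * aeval x f + aeval x b * aeval x f.derivative) • D x := by
          rw [hD, hY]; module
      _ = D x := by rw [hab', one_smul]
  have h3 : (algebraMap R (ChartRing F) c * aeval x f.derivative) • η = D y := by
    calc (algebraMap R (ChartRing F) c * aeval x f.derivative) • η =
          (algebraMap R (ChartRing F) c * aeval x a * y) • aeval x f.derivative • D x +
          (2 * algebraMap R (ChartRing F) c) • (aeval x b * aeval x f.derivative) • D y := by
            simp only [η]; module
      _ = ((2 * algebraMap R (ChartRing F) c) * (aeval x a * y ^ 2)) • D y +
          (2 * algebraMap R (ChartRing F) c) • (aeval x b * aeval x f.derivative) • D y := by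
            rw [← hD]; module
      _ = (aeval x a * aeval x f + aeval x b * aeval x f.derivative) • D y := by
          rw [hY, hc']; module
      _ = D y := by rw [hab', one_smul]
  refine ⟨η, h1, ?_, ?_⟩
  · intro s t hst
    have hρ : ρ η = 1 := by
      rw [map_add, map_smul, map_smul, hx, hy, ← hab', ← hY]
      simp only [smul_eq_mul, Algebra.smul_def]
      linear_combination aeval x b * aeval x f.derivative * hc'
    have := congrArg ρ hst
    simpa [hρ] using this
  · intro m
    have hspan : m ∈ Submodule.span (ChartRing F) {η} := by
      have mx : D x ∈ Submodule.span (ChartRing F) {η} :=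
        Submodule.mem_span_singleton.2 ⟨_, h1⟩
      have my : D y ∈ Submodule.span (ChartRing F) {η} :=
        Submodule.mem_span_singleton.2 ⟨_, h3⟩
      induction m using kaehler_induction with
      | h0 => exact zero_mem _
      | hadd m n hm hn => exact add_mem hm hn
      | hD s t =>
        refine Submodule.smul_mem _ _ ?_
        obtain ⟨p, q, rfl⟩ := exists_coord F t
        rw [map_add, Derivation.leibniz, Derivation.map_aeval, Derivation.map_aeval]
        exact add_mem (Submodule.smul_mem _ _ mx) (add_mem (Submodule.smul_mem _ _ my)
          (Submodule.smul_mem _ _ (Submodule.smul_mem _ _ mx)))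
    exact Submodule.mem_span_singleton.1 hspan

end Generator

/-! ### Global differentials -/

section GlobalBasis
variable {R : Type u} [CommRing R]

/-- `η` is the differential `dx / y` on the chart `z ≠ 0` and freely generates the differentials
there. -/
structure IsChartForm {d : ℕ} (F : BinaryForm R d) (η : Ω[ChartRing F⁄R]) : Prop where
  smul_eq : chartY F • η = KaehlerDifferential.D R _ (chartX F)
  bijective : Function.Bijective (fun a : ChartRing F => a • η)

variable {g : ℕ} {F : BinaryForm R (2 * g + 2)}

theorem IsChartForm.smul_eq_zero {η : Ω[ChartRing F⁄R]} (hη : IsChartForm F η) {a : ChartRing F}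
    (h : a • η = 0) : a = 0 :=
  hη.bijective.1 (by simpa using h)

theorem IsChartForm.pull_eq_zero {η : Ω[ChartRing F⁄R]} (hη : IsChartForm F η) {a : ChartRing F}
    (h : pull (overlapLeft F) (a • η) = 0) : a = 0 := by
  rw [overlapLeft, pull_toAlgHom,
    ← map_zero (KaehlerDifferential.map R R (ChartRing F) (OverlapRing F))] at h
  obtain ⟨⟨_, n, rfl⟩, hn⟩ := (IsLocalizedModule.eq_iff_exists (Submonoid.powers (chartX F))
    (KaehlerDifferential.map R R (ChartRing F) (OverlapRing F))).1 h
  change chartX F ^ n • a • η = chartX F ^ n • 0 at hn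
  rw [smul_zero, ← mul_smul] at hn
  exact (mul_left_mem_nonZeroDivisors_eq_zero_iff (chartX_pow_mem_nonZeroDivisors F n)).1
    (hη.smul_eq_zero hn)

/-- The differentials on the overlap are a localization of the free module generated by `η`, so
nonzerodivisors of the chart are injective on them. -/
theorem IsChartForm.smul_left_cancel {η : Ω[ChartRing F⁄R]} (hη : IsChartForm F η)
    {a : ChartRing F} (ha : a ∈ nonZeroDivisors (ChartRing F)) {m : Ω[OverlapRing F⁄R]}
    (h : overlapLeft F a • m = 0) : m = 0 := by
  obtain ⟨⟨n, _, k, rfl⟩, hk⟩ := IsLocalizedModule.surj (Submonoid.powers (chartX F))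
    (KaehlerDifferential.map R R (ChartRing F) (OverlapRing F)) m
  obtain ⟨b, rfl⟩ := hη.bijective.2 n
  change chartX F ^ k • m = KaehlerDifferential.map R R _ _ (b • η) at hk
  rw [← pull_toAlgHom] at hk
  have h1 : pull (overlapLeft F) ((a * b) • η) = 0 := by
    rw [mul_smul, pull_smul]
    change overlapLeft F a •
      pull (IsScalarTower.toAlgHom R (ChartRing F) (OverlapRing F)) (b • η) = 0
    rw [← hk, smul_comm, h, smul_zero]
  have hb : b = 0 := (mul_left_mem_nonZeroDivisors_eq_zero_iff ha).1 (hη.pull_eq_zero h1)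
  rw [hb, zero_smul, map_zero] at hk
  have h2 : (((overlapX F) ^ k : (OverlapRing F)ˣ) : OverlapRing F) • m = 0 := by
    rw [← hk, ← algebraMap_smul (OverlapRing F) (chartX F ^ k) m, map_pow]
    simp [overlapX]
  exact ((overlapX F) ^ k).isUnit.smul_eq_zero.1 h2

theorem overlapLeft_chartX : overlapLeft F (chartX F) = overlapX F := rfl

theorem overlapRight_chartX : overlapRight F (chartX F.rev) = ↑(overlapX F)⁻¹ := by
  simp [overlapRight, toChart, chartHom_X]

theorem overlapRight_chartY : overlapRight F (chartY F.rev) =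
    ↑(overlapX F)⁻¹ ^ (g + 1) * overlapLeft F (chartY F) := by
  simp only [overlapRight, toChart, chartHom_Y]; rfl

theorem overlapLeft_aeval (p : R[X]) :
    overlapLeft F (aeval (chartX F) p) = aeval (overlapX F : OverlapRing F) p := by
  rw [← aeval_algHom_apply, overlapLeft_chartX]

theorem aeval_unit_inv_mul_pow {T : Type*} [CommRing T] [Algebra R T] (x : Tˣ) (p : R[X]) (n : ℕ)
    (hp : p.natDegree ≤ n) :
    aeval (↑x⁻¹ : T) p * (x : T) ^ n = aeval (x : T) (reflect n p) := by
  let _ : Invertible (↑x⁻¹ : T) := ⟨x, x.mul_inv, x.inv_mul⟩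
  have h := eval₂_reflect_mul_pow (algebraMap R T) (↑x⁻¹ : T) n p hp
  have hx : (⅟(↑x⁻¹ : T)) = x := rfl
  rw [hx] at h
  change aeval (x : T) (reflect n p) * _ = aeval (↑x⁻¹ : T) p at h
  rw [← h, mul_assoc, ← mul_pow, Units.inv_mul, one_pow, mul_one]

theorem _root_.Derivation.pow_smul_units_inv {T M : Type*} [CommRing T] [Algebra R T]
    [AddCommGroup M] [Module T M] [Module R M] (D : Derivation R T M) (x : Tˣ) (n : ℕ) :
    (x : T) ^ (n + 1 + 1) • D ↑x⁻¹ = -((x : T) ^ n • D ↑x) := by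
  have h : (x : T) • D ↑x⁻¹ + (↑x⁻¹ : T) • D x = 0 := by
    rw [← Derivation.leibniz, Units.mul_inv, Derivation.map_one_eq_zero]
  rw [eq_neg_iff_add_eq_zero]
  calc (x : T) ^ (n + 1 + 1) • D ↑x⁻¹ + (x : T) ^ n • D ↑x
      = (x : T) ^ (n + 1 + 1) • D ↑x⁻¹ + ((x : T) ^ n * (x * ↑x⁻¹)) • D ↑x := by
        rw [Units.mul_inv, mul_one]
    _ = ((x : T) ^ n * x) • ((x : T) • D ↑x⁻¹ + (↑x⁻¹ : T) • D x) := by module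
    _ = 0 := by rw [h, smul_zero]

/-- In the coordinates of the first chart, the generator of the second one is `-x^(g-1) dx / y`. -/
theorem pull_overlapRight_chartForm (hg : 1 ≤ g) (hy : chartY F ∈ nonZeroDivisors (ChartRing F))
    {η : Ω[ChartRing F⁄R]} (hη : IsChartForm F η) {η' : Ω[ChartRing F.rev⁄R]}
    (hη' : IsChartForm F.rev η') :
    pull (overlapRight F) η' =
      -((overlapX F : OverlapRing F) ^ (g - 1) • pull (overlapLeft F) η) := by
  have h1 := congrArg (pull (overlapLeft F)) hη.smul_eq
  have h2 := congrArg (pull (overlapRight F)) hη'.smul_eq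
  rw [pull_smul, pull_D, overlapLeft_chartX] at h1
  rw [pull_smul, pull_D, overlapRight_chartX, overlapRight_chartY] at h2
  set x := overlapX F
  set D := KaehlerDifferential.D R (OverlapRing F)
  have h5 : (x : OverlapRing F) ^ (g + 1) • D ↑x⁻¹ =
      overlapLeft F (chartY F) • pull (overlapRight F) η' := by
    rw [← h2, ← mul_smul, ← mul_assoc, ← mul_pow, Units.mul_inv, one_pow, one_mul]
  have h4 : overlapLeft F (chartY F) •
      (pull (overlapRight F) η' + (x : OverlapRing F) ^ (g - 1) • pull (overlapLeft F) η) = 0 := by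
    obtain ⟨n, rfl⟩ : ∃ n, g = n + 1 := ⟨g - 1, by omega⟩
    rw [Nat.add_sub_cancel, smul_add,
      smul_comm (overlapLeft F (chartY F)) ((x : OverlapRing F) ^ n), ← h5, h1]
    rw [D.pow_smul_units_inv x n, neg_add_cancel]
  exact eq_neg_of_add_eq_zero_left (hη.smul_left_cancel hy h4)

/-- The differential with components `a η` and `b η'` on the charts is regular only if `a` is a
polynomial in `x` of degree less than `g`, and it is determined by `a`. -/
theorem exists_degree_lt_of_pull_eq (hg : 1 ≤ g) (hy : chartY F ∈ nonZeroDivisors (ChartRing F))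
    {η : Ω[ChartRing F⁄R]} (hη : IsChartForm F η) {η' : Ω[ChartRing F.rev⁄R]}
    (hη' : IsChartForm F.rev η') {a : ChartRing F} {b : ChartRing F.rev}
    (h : pull (overlapLeft F) (a • η) = pull (overlapRight F) (b • η')) :
    (∃ p : R[X], p.degree < g ∧ a = aeval (chartX F) p) ∧ (a = 0 → b = 0) := by
  rcases subsingleton_or_nontrivial R with hR | hR
  · have := Module.subsingleton R (ChartRing F)
    have := Module.subsingleton R (ChartRing F.rev)
    exact ⟨⟨0, by simp, Subsingleton.elim _ _⟩, fun _ => Subsingleton.elim _ _⟩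
  obtain ⟨p₀, p₁, rfl⟩ := exists_coord F a
  obtain ⟨q₀, q₁, rfl⟩ := exists_coord F.rev b
  -- On the overlap `b` is a polynomial in `1 / x` and `y / x^(g+1)`. Multiplication by `x^(M+g+1)`
  -- clears the denominators, and the coefficients of `1` and `y` are compared by degree.
  obtain ⟨M, hM₀, hM₁⟩ : ∃ M, q₀.natDegree ≤ M ∧ q₁.natDegree ≤ M :=
    ⟨max q₀.natDegree q₁.natDegree, le_max_left _ _, le_max_right _ _⟩
  set r₀ := reflect M q₀ with hr₀
  set r₁ := reflect M q₁ with hr₁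
  have e : (overlapX F : OverlapRing F) ^ (M + (g + 1)) *
      overlapRight F (aeval (chartX F.rev) q₀ + aeval (chartX F.rev) q₁ * chartY F.rev) =
        overlapLeft F (aeval (chartX F) (X ^ (g + 1) * r₀) + aeval (chartX F) r₁ * chartY F) := by
    rw [map_add, map_mul, ← aeval_algHom_apply, ← aeval_algHom_apply, overlapRight_chartX,
      overlapRight_chartY, map_add, map_mul (overlapLeft F), overlapLeft_aeval, overlapLeft_aeval,
      map_mul, map_pow, aeval_X, hr₀, hr₁, ← aeval_unit_inv_mul_pow _ _ _ hM₀,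
      ← aeval_unit_inv_mul_pow _ _ _ hM₁]
    have hx : ((overlapX F : OverlapRing F) * ↑(overlapX F)⁻¹) ^ (g + 1) = 1 := by
      rw [Units.mul_inv, one_pow]
    rw [mul_pow] at hx
    rw [pow_add]
    linear_combination (overlapX F : OverlapRing F) ^ M *
      aeval (↑(overlapX F)⁻¹ : OverlapRing F) q₁ * overlapLeft F (chartY F) * hx
  rw [pull_smul _ _ η', pull_overlapRight_chartForm hg hy hη hη'] at h
  have h1 : pull (overlapLeft F) ((aeval (chartX F)
        (X ^ (M + (g + 1)) * p₀ + X ^ (g - 1) * (X ^ (g + 1) * r₀)) +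
      aeval (chartX F) (X ^ (M + (g + 1)) * p₁ + X ^ (g - 1) * r₁) * chartY F) • η) = 0 := by
    have h2 := congrArg ((overlapX F : OverlapRing F) ^ (M + (g + 1)) • ·) h
    simp only [smul_neg] at h2
    rw [← mul_smul, e, ← overlapLeft_chartX, ← map_pow, ← map_pow, ← pull_smul, ← pull_smul,
      ← pull_smul, ← map_neg, ← sub_eq_zero, ← map_sub] at h2
    rw [← h2]
    congr 1
    simp only [map_add, map_mul, map_pow, aeval_X]
    module
  obtain ⟨hz₀, hz₁⟩ := coord_eq_zero F (hη.pull_eq_zero h1)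
  have k₀ : X ^ (M + (g + 1)) * p₀ = -(r₀ * X ^ (2 * g)) := by
    obtain ⟨n, rfl⟩ : ∃ n, g = n + 1 := ⟨g - 1, by omega⟩
    rw [Nat.add_sub_cancel] at hz₀
    linear_combination hz₀
  have k₁ : X ^ (M + (g + 1)) * p₁ = -(r₁ * X ^ (g - 1)) := by linear_combination hz₁
  have dr (q : R[X]) (hq : q.natDegree ≤ M) : (reflect M q).natDegree ≤ M := by
    rw [natDegree_le_iff_coeff_eq_zero]
    intro n hn
    rw [coeff_reflect, revAt_eq_self_of_lt hn]
    exact coeff_eq_zero_of_natDegree_lt (hq.trans_lt hn)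
  have hp₁ : p₁ = 0 := by
    by_contra hne
    have h3 := congrArg natDegree k₁
    rw [natDegree_X_pow_mul _ hne, natDegree_neg] at h3
    have h4 := natDegree_mul_le (p := r₁) (q := X ^ (g - 1))
    rw [natDegree_X_pow] at h4
    have : r₁.natDegree ≤ M := dr q₁ hM₁
    omega
  have hp₀ : p₀ ≠ 0 → p₀.natDegree < g := by
    intro hne
    have h3 := congrArg natDegree k₀
    rw [natDegree_X_pow_mul _ hne, natDegree_neg] at h3
    have h4 := natDegree_mul_le (p := r₀) (q := X ^ (2 * g))
    rw [natDegree_X_pow] at h4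
    have : r₀.natDegree ≤ M := dr q₀ hM₀
    omega
  subst hp₁
  refine ⟨⟨p₀, ?_, by simp⟩, fun hz => ?_⟩
  · by_cases hne : p₀ = 0
    · rw [hne, degree_zero]; exact WithBot.bot_lt_coe g
    · rw [degree_eq_natDegree hne]; exact_mod_cast hp₀ hne
  · have hp₀ : p₀ = 0 := (coord_eq_zero F hz).1
    rw [hp₀, mul_zero, zero_eq_neg] at k₀
    rw [mul_zero, zero_eq_neg] at k₁
    have z (n : ℕ) (r : R[X]) (hr : r * X ^ n = 0) : r = 0 :=
      (mul_right_mem_nonZeroDivisors_eq_zero_iff (monic_X_pow n).mem_nonZeroDivisors).1 hr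
    rw [reflect_eq_zero_iff.1 (z _ _ k₀), reflect_eq_zero_iff.1 (z _ _ k₁)]
    simp

variable (F) in
/-- The global differential `x^i dx / y`, characterized by `y ω = x^i dx` on the chart `z = 1`. -/
def IsMonomial (i : ℕ) (ω : globalDifferentials F) : Prop :=
  chartY F • ω.1.1 = chartX F ^ i • KaehlerDifferential.D R _ (chartX F)

/-- The differential `x^i dx / y` extends to the second chart, where it is `-z^(g-1-i) dz / y`. -/
theorem exists_isMonomial (hg : 1 ≤ g) (hy : chartY F ∈ nonZeroDivisors (ChartRing F))
    {η : Ω[ChartRing F⁄R]} (hη : IsChartForm F η) {η' : Ω[ChartRing F.rev⁄R]}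
    (hη' : IsChartForm F.rev η') {i : ℕ} (hi : i < g) :
    ∃ ω : globalDifferentials F, ω.1.1 = chartX F ^ i • η := by
  refine ⟨⟨(chartX F ^ i • η, -(chartX F.rev ^ (g - 1 - i) • η')), ?_⟩, rfl⟩
  change pull (overlapLeft F) (chartX F ^ i • η) =
    pull (overlapRight F) (-(chartX F.rev ^ (g - 1 - i) • η'))
  rw [map_neg, pull_smul, pull_smul, pull_overlapRight_chartForm hg hy hη hη', map_pow, map_pow,
    overlapLeft_chartX, overlapRight_chartX, smul_neg, neg_neg, ← mul_smul]
  congr 1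
  have e : (overlapX F : OverlapRing F) ^ (g - 1) =
      (overlapX F : OverlapRing F) ^ (g - 1 - i) * overlapX F ^ i := by
    rw [← pow_add]; congr 1; omega
  rw [e, ← mul_assoc, ← mul_pow, Units.inv_mul, one_pow, one_mul]

/-- A global differential is determined by its restriction to the chart `z ≠ 0`. -/
theorem globalDifferentials_ext (hg : 1 ≤ g) (hy : chartY F ∈ nonZeroDivisors (ChartRing F))
    {η : Ω[ChartRing F⁄R]} (hη : IsChartForm F η) {η' : Ω[ChartRing F.rev⁄R]}
    (hη' : IsChartForm F.rev η') {ω θ : globalDifferentials F} (h : ω.1.1 = θ.1.1) : ω = θ := by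
  rw [← sub_eq_zero]
  set δ := ω - θ
  have h0 : δ.1.1 = 0 := sub_eq_zero.2 h
  obtain ⟨b, hb⟩ := hη'.bijective.2 δ.1.2
  have hδ : pull (overlapLeft F) δ.1.1 = pull (overlapRight F) δ.1.2 := δ.2
  have := (exists_degree_lt_of_pull_eq (a := 0) (b := b) hg hy hη hη' (by
    rw [zero_smul, ← h0, hδ, ← hb])).2 rfl
  rw [this] at hb
  refine Subtype.ext (Prod.ext h0 ?_)
  simpa using hb.symm

/-- The differentials `x^i dx / y`, `0 ≤ i < g`, form a basis of the global differentials. -/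
theorem exists_monomial_basis (hg : 1 ≤ g) (hy : chartY F ∈ nonZeroDivisors (ChartRing F))
    {η : Ω[ChartRing F⁄R]} (hη : IsChartForm F η) {η' : Ω[ChartRing F.rev⁄R]}
    (hη' : IsChartForm F.rev η') :
    ∃ b : Module.Basis (Fin g) R (globalDifferentials F),
      ∀ i, (b i).1.1 = chartX F ^ (i : ℕ) • η := by
  choose ω hω using fun i : Fin g => exists_isMonomial hg hy hη hη' i.2
  have key (c : Fin g → R) : (∑ i, c i • ω i).1.1 =
      aeval (chartX F) (∑ i : Fin g, C (c i) * X ^ (i : ℕ)) • η := by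
    have : (∑ i, c i • ω i).1.1 = ∑ i, c i • (ω i).1.1 := by
      simp [Prod.fst_sum]
    rw [this, map_sum, Finset.sum_smul]
    refine Finset.sum_congr rfl fun i _ => ?_
    rw [hω, map_mul, aeval_C, map_pow, aeval_X, mul_smul, algebraMap_smul]
  have cf (c : Fin g → R) (j : Fin g) :
      (∑ i : Fin g, C (c i) * X ^ (i : ℕ) : R[X]).coeff j = c j := by
    simp [coeff_X_pow, Fin.val_inj]
  refine ⟨Module.Basis.mk (v := ω) ?_ ?_, fun i => by rw [Module.Basis.mk_apply, hω]⟩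
  · rw [Fintype.linearIndependent_iff]
    intro c hc j
    have h1 := key c
    rw [hc] at h1
    have h2 := hη.smul_eq_zero h1.symm
    rw [← map_zero (aeval (R := R) (chartX F))] at h2
    rw [← cf c j, aeval_chartX_injective F h2, coeff_zero]
  · intro θ _
    obtain ⟨a, ha⟩ := hη.bijective.2 θ.1.1
    obtain ⟨b, hb⟩ := hη'.bijective.2 θ.1.2
    have hθ : pull (overlapLeft F) θ.1.1 = pull (overlapRight F) θ.1.2 := θ.2
    obtain ⟨p, hp, rfl⟩ := (exists_degree_lt_of_pull_eq (a := a) (b := b) hg hy hη hη' (by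
      simp only at ha hb
      rw [ha, hb, hθ])).1
    have : θ = ∑ i : Fin g, p.coeff i • ω i := by
      apply globalDifferentials_ext hg hy hη hη'
      rw [key, ← ha]
      simp only
      congr 2
      ext n
      by_cases hn : n < g
      · exact (cf (fun i => p.coeff i) ⟨n, hn⟩).symm
      · rw [coeff_eq_zero_of_degree_lt (hp.trans_le (by exact_mod_cast not_lt.1 hn))]
        simp only [finsetSum_coeff, coeff_C_mul, coeff_X_pow]
        symm
        refine Finset.sum_eq_zero fun i _ => ?_
        rw [if_neg (by have := i.2; omega), mul_zero]
    rw [this]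
    exact Submodule.sum_mem _ fun i _ => Submodule.smul_mem _ _ (Submodule.subset_span ⟨i, rfl⟩)

theorem IsChartForm.isMonomial_iff (hy : chartY F ∈ nonZeroDivisors (ChartRing F))
    {η : Ω[ChartRing F⁄R]} (hη : IsChartForm F η) {i : ℕ} {ω : globalDifferentials F} :
    IsMonomial F i ω ↔ ω.1.1 = chartX F ^ i • η := by
  constructor
  · intro h
    obtain ⟨a, ha⟩ := hη.bijective.2 ω.1.1
    rw [IsMonomial, ← hη.smul_eq, ← ha] at h
    rw [← ha]
    simp only at h ⊢
    rw [smul_comm (chartX F ^ i), ← mul_smul, ← mul_smul] at h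
    have := hη.bijective.1 h
    rw [(mul_cancel_left_mem_nonZeroDivisors hy).1 this]
  · intro h
    rw [IsMonomial, h, smul_comm, hη.smul_eq]

variable (F) in
theorem chartY_mem_nonZeroDivisors_of_disc (hF : IsUnit F.disc) :
    chartY F ∈ nonZeroDivisors (ChartRing F) := by
  exact chartY_mem_nonZeroDivisors F (eval_X_one_mem_nonZeroDivisors (by omega) F hF)

variable (F) in
theorem exists_isChartForm (h2 : IsUnit (2 : R)) (hF : IsUnit F.disc) :
    ∃ (η : Ω[ChartRing F⁄R]) (η' : Ω[ChartRing F.rev⁄R]),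
      IsChartForm F η ∧ IsChartForm F.rev η' := by
  obtain ⟨η, h1, h1'⟩ := exists_chartForm F h2 (isCoprime_derivative (by omega) F hF)
  obtain ⟨η', h3, h3'⟩ := exists_chartForm F.rev h2 (isCoprime_derivative_rev (by omega) F hF)
  exact ⟨η, η', ⟨h1, h1'⟩, ⟨h3, h3'⟩⟩

theorem existsUnique_isMonomial (hg : 1 ≤ g) (h2 : IsUnit (2 : R)) (hF : IsUnit F.disc) {i : ℕ}
    (hi : i < g) : ∃! ω : globalDifferentials F, IsMonomial F i ω := by
  obtain ⟨η, η', hη, hη'⟩ := exists_isChartForm F h2 hF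
  have hy := chartY_mem_nonZeroDivisors_of_disc F hF
  obtain ⟨ω, hω⟩ := exists_isMonomial hg hy hη hη' hi
  refine ⟨ω, (hη.isMonomial_iff hy).2 hω, fun θ hθ => globalDifferentials_ext hg hy hη hη' ?_⟩
  rw [(hη.isMonomial_iff hy).1 hθ, hω]

/-- Any family of differentials `x^i dx / y`, `0 ≤ i < g`, is a basis. -/
theorem IsMonomial.exists_basis (hg : 1 ≤ g) (h2 : IsUnit (2 : R)) (hF : IsUnit F.disc)
    {ω : Fin g → globalDifferentials F} (hω : ∀ i : Fin g, IsMonomial F i (ω i)) :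
    ∃ b : Module.Basis (Fin g) R (globalDifferentials F), ⇑b = ω := by
  obtain ⟨η, η', hη, hη'⟩ := exists_isChartForm F h2 hF
  have hy := chartY_mem_nonZeroDivisors_of_disc F hF
  obtain ⟨b, hb⟩ := exists_monomial_basis hg hy hη hη'
  refine ⟨b, funext fun i => ?_⟩
  exact (existsUnique_isMonomial hg h2 hF i.2).unique ((hη.isMonomial_iff hy).2 (hb i)) (hω i)

end GlobalBasis

/-! ### The action of `GL₂` on the monomial differentials -/

section PullbackMonomial

/-- The linear form with coefficients the `i`-th row of `u`, as a polynomial in `x` with `z = 1`. -/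
def rowPoly {R : Type*} [CommRing R] (u : GL (Fin 2) R) (i : Fin 2) : R[X] :=
  C (u.1 i 0) * X + C (u.1 i 1)

theorem aeval_rowPoly {R T : Type u} [CommRing R] [CommRing T] [Algebra R T] (u : GL (Fin 2) R)
    (i : Fin 2) (x : T) : aeval x (rowPoly u i) = linForm u i x 1 := by
  simp [rowPoly, linForm]

/-- The quotient rule for a Möbius transformation of `x`. -/
theorem sq_smul_D_mobius {R T : Type u} [CommRing R] [CommRing T] [Algebra R T]
    (u : GL (Fin 2) R) (x : T) (z : Tˣ) (hz : (z : T) = linForm u 1 x 1) :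
    (z : T) ^ 2 • KaehlerDifferential.D R T (↑z⁻¹ * linForm u 0 x 1) =
      algebraMap R T u.1.det • KaehlerDifferential.D R T x := by
  have hl (i : Fin 2) : KaehlerDifferential.D R T (linForm u i x 1) =
      algebraMap R T (u.1 i 0) • KaehlerDifferential.D R T x := by
    simp [linForm]
  set t := ↑z⁻¹ * linForm u 0 x 1 with ht
  have h0 : (z : T) * t = linForm u 0 x 1 := by rw [ht, Units.mul_inv_cancel_left]
  have h1 := hl 0
  have h2 := hl 1
  rw [← h0, Derivation.leibniz] at h1
  rw [← hz] at h2
  rw [h2] at h1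
  have h3 : (z : T) ^ 2 • KaehlerDifferential.D R T t =
      ((z : T) * algebraMap R T (u.1 0 0) - ((z : T) * t) * algebraMap R T (u.1 1 0)) •
        KaehlerDifferential.D R T x := by
    rw [sub_smul, mul_smul _ (algebraMap R T (u.1 0 0)), ← h1]
    module
  rw [h3, h0, hz, Matrix.det_fin_two]
  congr 1
  simp only [linForm, map_sub, map_mul]
  ring

variable {K : Type u} [Field K] {g : ℕ} {F F' : BinaryForm K (2 * g + 2)}

theorem rowPoly_ne_zero (u : GL (Fin 2) K) (i : Fin 2) : rowPoly u i ≠ 0 := by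
  intro h
  have h0 : u.1 i 0 = 0 := by simpa [rowPoly] using congrArg (coeff · 1) h
  have h1 : u.1 i 1 = 0 := by simpa [rowPoly] using congrArg (coeff · 0) h
  apply (Matrix.isUnit_iff_isUnit_det u.1).1 u.isUnit |>.ne_zero
  rw [Matrix.det_eq_zero_of_row_eq_zero i]
  intro j
  fin_cases j
  exacts [h0, h1]

/-- On the open set where `(u(x, 1))₁` is invertible, `φ_u^*(x^i dx / y)` is computed by the
quotient rule. -/
theorem pull_pullbackAct_fst (u : GL (Fin 2) K) (hF : F' = F.act u) {i : ℕ}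
    (hi : i < g) {ω : globalDifferentials F'} (hω : IsMonomial F' i ω) :
    pull (IsScalarTower.toAlgHom K (ChartRing F) (Localization.Away (linForm u 1 (chartX F) 1)))
      (chartY F • (pullbackAct u F F' hF ω).1.1) =
    pull (IsScalarTower.toAlgHom K (ChartRing F) (Localization.Away (linForm u 1 (chartX F) 1)))
      ((algebraMap K _ u.1.det * (linForm u 0 (chartX F) 1 ^ i *
        linForm u 1 (chartX F) 1 ^ (g - 1 - i))) • KaehlerDifferential.D K _ (chartX F)) := by
  set x := chartX F
  set y := chartY F
  set m := (pullbackAct u F F' hF ω).1.1 with hm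
  set l := linForm u 1 x 1 with hl
  have hspec := (pullbackAt_spec F' (linForm u 0 x 1) y l (chart_point F F' u hF)
    (linForm_coprime u isCoprime_one_right) ω).1
  have hlu : IsUnit (algebraMap (ChartRing F) (Localization.Away l) l) :=
    IsLocalization.Away.algebraMap_isUnit l
  let ψ := IsScalarTower.toAlgHom K (ChartRing F) (Localization.Away l)
  let z : (Localization.Away l)ˣ := hlu.unit
  have hz : ψ l = z := rfl
  have hz' : (z : Localization.Away l) = linForm u 1 (ψ x) 1 := by
    rw [← hz]
    exact (map_linForm ψ u 1 x 1).trans (by rw [map_one])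
  have h1 := hspec _ ψ z (by rw [← hz]; exact point_map (chart_point F F' u hF) ψ) hz
  change pull ψ m = _ at h1
  set ξ := toChart F' (ψ (linForm u 0 x 1)) (ψ y) z
    (by rw [← hz]; exact point_map (chart_point F F' u hF) ψ) with hξ
  have hX : ξ (chartX F') = ↑z⁻¹ * linForm u 0 (ψ x) 1 := by
    rw [hξ, toChart, chartHom_X, map_linForm, map_one]
  have hY : ξ (chartY F') = ↑z⁻¹ ^ (g + 1) * ψ y := by rw [hξ, toChart, chartHom_Y]
  have h2 := congrArg (pull ξ) hω
  rw [pull_smul, pull_smul, pull_D, ← h1, map_pow, hY, hX] at h2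
  have h3 := sq_smul_D_mobius u (ψ x) z hz'
  have hL : ψ (linForm u 0 x 1) = linForm u 0 (ψ x) 1 :=
    (map_linForm ψ u 0 x 1).trans (by rw [map_one])
  have e : ψ (algebraMap K _ u.1.det * (linForm u 0 x 1 ^ i * l ^ (g - 1 - i))) =
      algebraMap K _ u.1.det *
        (linForm u 0 (ψ x) 1 ^ i * (z : Localization.Away l) ^ (g - 1 - i)) := by
    rw [← hL, ← hz, ← ψ.commutes]
    generalize algebraMap K (ChartRing F) u.1.det = c
    simp only [map_mul, map_pow]
  have hc (n : ℕ) : (z : Localization.Away l) ^ n * ↑z⁻¹ ^ n = 1 := by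
    rw [← mul_pow, Units.mul_inv, one_pow]
  change pull ψ (y • m) = pull ψ ((algebraMap K _ u.1.det *
    (linForm u 0 x 1 ^ i * l ^ (g - 1 - i))) • KaehlerDifferential.D K _ x)
  rw [pull_smul, pull_smul, pull_D]
  calc ψ y • pull ψ m =
        (z : Localization.Away l) ^ (g + 1) • (↑z⁻¹ ^ (g + 1) * ψ y) • pull ψ m := by
        rw [← mul_smul, ← mul_assoc, hc, one_mul]
    _ = ((z : Localization.Away l) ^ (g - 1 - i) * linForm u 0 (ψ x) 1 ^ i * (z ^ i * ↑z⁻¹ ^ i)) •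
          (z : Localization.Away l) ^ 2 •
            KaehlerDifferential.D K (Localization.Away l) (↑z⁻¹ * linForm u 0 (ψ x) 1) := by
        rw [h2, ← mul_smul, ← mul_smul]
        congr 1
        have : g + 1 = (g - 1 - i) + i + 2 := by omega
        rw [mul_pow]
        conv_lhs => rw [this, pow_add, pow_add]
        ring
    _ = _ := by
        rw [h3, hc, mul_one, ← mul_smul]
        congr 1
        rw [e]
        ring

theorem exists_pow_smul_eq {T M N : Type*} [CommRing T] [AddCommGroup M] [Module T M]
    [AddCommGroup N] [Module T N] {z : T} (l : M →ₗ[T] N)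
    [IsLocalizedModule (Submonoid.powers z) l] {m m' : M} (h : l m = l m') :
    ∃ n : ℕ, z ^ n • m = z ^ n • m' := by
  obtain ⟨⟨_, n, rfl⟩, hn⟩ := (IsLocalizedModule.eq_iff_exists (Submonoid.powers z) l).1 h
  exact ⟨n, hn⟩

/-- Two differentials which agree where a nonzerodivisor is invertible agree. -/
theorem IsChartForm.pull_away_injective {R : Type u} [CommRing R] {d : ℕ} {F : BinaryForm R d}
    {η : Ω[ChartRing F⁄R]} (hη : IsChartForm F η) {l : ChartRing F}
    (hl : l ∈ nonZeroDivisors (ChartRing F)) :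
    Function.Injective (pull (IsScalarTower.toAlgHom R (ChartRing F) (Localization.Away l))) := by
  intro m m' h
  rw [pull_toAlgHom, pull_toAlgHom] at h
  obtain ⟨n, hn⟩ := exists_pow_smul_eq (z := l) _ h
  obtain ⟨a, rfl⟩ := hη.bijective.2 m
  obtain ⟨b, rfl⟩ := hη.bijective.2 m'
  simp only [← mul_smul] at hn
  rw [(mul_cancel_left_mem_nonZeroDivisors (pow_mem hl n)).1 (hη.bijective.1 hn)]

/-- The pullback of `x^i dx / y` along `φ_u` is `det u · (u(x, 1))₀^i (u(x, 1))₁^(g-1-i) dx / y`. It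
suffices to compare the two sides on the open set where `(u(x, 1))₁` is invertible. -/
theorem pullbackAct_fst (hy : chartY F ∈ nonZeroDivisors (ChartRing F))
    {η : Ω[ChartRing F⁄K]} (hη : IsChartForm F η) (u : GL (Fin 2) K) (hF : F' = F.act u) {i : ℕ}
    (hi : i < g) {ω : globalDifferentials F'} (hω : IsMonomial F' i ω) :
    (pullbackAct u F F' hF ω).1.1 =
      aeval (chartX F) (C u.1.det * (rowPoly u 0 ^ i * rowPoly u 1 ^ (g - 1 - i))) • η := by
  have hl : linForm u 1 (chartX F) 1 ∈ nonZeroDivisors (ChartRing F) := by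
    rw [← aeval_rowPoly]
    exact aeval_chartX_mem_nonZeroDivisors F (mem_nonZeroDivisors_of_ne_zero (rowPoly_ne_zero u 1))
  have hn := hη.pull_away_injective hl (pull_pullbackAct_fst u hF hi hω)
  obtain ⟨a, ha⟩ := hη.bijective.2 (pullbackAct u F F' hF ω).1.1
  simp only at ha
  rw [← ha, ← hη.smul_eq, ← mul_smul, ← mul_smul] at hn
  have h5 := hη.bijective.1 hn
  rw [mul_comm _ (chartY F)] at h5
  have h6 := (mul_cancel_left_mem_nonZeroDivisors hy).1 h5
  rw [← ha, h6, map_mul, aeval_C, map_mul, map_pow, map_pow, aeval_rowPoly, aeval_rowPoly]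

/-- The matrix of `Sym^(g-1) u` in the basis of monomials: its `i`-th row holds the coefficients of
`(u(x, 1))₀^i (u(x, 1))₁^(g-1-i)`. -/
def symMatrix (K : Type*) [CommRing K] (g : ℕ) (u : GL (Fin 2) K) : Matrix (Fin g) (Fin g) K :=
  .of fun i j => (rowPoly u 0 ^ (i : ℕ) * rowPoly u 1 ^ (g - 1 - i)).coeff j

theorem natDegree_row_mul_le (u : GL (Fin 2) K) (i : Fin g) :
    (rowPoly u 0 ^ (i : ℕ) * rowPoly u 1 ^ (g - 1 - i)).natDegree < g := by
  have h (j : Fin 2) : (rowPoly u j).natDegree ≤ 1 := natDegree_linear_le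
  have h1 := natDegree_mul_le (p := rowPoly u 0 ^ (i : ℕ)) (q := rowPoly u 1 ^ (g - 1 - i))
  have h2 := natDegree_pow_le_of_le (i : ℕ) (h 0)
  have h3 := natDegree_pow_le_of_le (g - 1 - i) (h 1)
  have := i.2
  omega

theorem pullbackAct_monomial (hg : 1 ≤ g) (h2 : (2 : K) ≠ 0) (hd : F.disc ≠ 0)
    (u : GL (Fin 2) K) (hF : F' = F.act u) {ω : Fin g → globalDifferentials F}
    (hω : ∀ i : Fin g, IsMonomial F i (ω i)) {ω' : Fin g → globalDifferentials F'}
    (hω' : ∀ i : Fin g, IsMonomial F' i (ω' i)) (i : Fin g) :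
    pullbackAct u F F' hF (ω' i) = ∑ j, (u.1.det • symMatrix K g u) i j • ω j := by
  have hdu : IsUnit F.disc := hd.isUnit
  obtain ⟨η, η', hη, hη'⟩ := exists_isChartForm F h2.isUnit hdu
  have hy := chartY_mem_nonZeroDivisors_of_disc F hdu
  apply globalDifferentials_ext hg hy hη hη'
  rw [pullbackAct_fst hy hη u hF i.2 (hω' i)]
  have : (∑ j, (u.1.det • symMatrix K g u) i j • ω j).1.1 =
      ∑ j, (u.1.det • symMatrix K g u) i j • (ω j).1.1 := by
    simp [Prod.fst_sum]
  rw [this, as_sum_range' _ g (natDegree_row_mul_le u i), Finset.sum_range,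
    Finset.mul_sum, map_sum, Finset.sum_smul]
  refine Finset.sum_congr rfl fun j _ => ?_
  rw [(hη.isMonomial_iff hy).1 (hω j), ← algebraMap_smul (ChartRing F) (_ : K), ← mul_smul]
  congr 1
  rw [map_mul, aeval_C, aeval_monomial, Matrix.smul_apply, smul_eq_mul, map_mul, mul_assoc]
  rfl

theorem det_symMatrix_of_infinite [Infinite K] (u : GL (Fin 2) K) :
    (symMatrix K g u).det = u.1.det ^ (g * (g - 1) / 2) := by
  let t : Fin g → K := fun i => Infinite.natEmbedding K i
  have ht : Function.Injective t := fun i j h =>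
    Fin.ext ((Infinite.natEmbedding K).injective h)
  have hl (j : Fin 2) (s : K) : (rowPoly u j).eval s = u.1 j 0 * s + u.1 j 1 := by simp [rowPoly]
  -- Evaluating the polynomials at the points `t` turns a Vandermonde matrix into a projective one.
  have h1 : Matrix.vandermonde t * (symMatrix K g u).transpose =
      Matrix.projVandermonde (fun i => (rowPoly u 0).eval (t i))
        (fun i => (rowPoly u 1).eval (t i)) := by
    ext i j
    rw [Matrix.mul_apply, Matrix.projVandermonde_apply, ← eval_pow, ← eval_pow, ← eval_mul]
    have e : ((Fin.rev j : Fin g) : ℕ) = g - 1 - j := by rw [Fin.val_rev]; omega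
    rw [e, eval_eq_sum_range' (natDegree_row_mul_le u j), Finset.sum_range]
    refine Finset.sum_congr rfl fun k _ => ?_
    rw [Matrix.vandermonde_apply, Matrix.transpose_apply, mul_comm]
    rfl
  have h2 := congrArg Matrix.det h1
  rw [Matrix.det_mul, Matrix.det_transpose, Matrix.det_projVandermonde] at h2
  have h3 : ∀ i j : Fin g, (rowPoly u 0).eval (t j) * (rowPoly u 1).eval (t i) -
      (rowPoly u 0).eval (t i) * (rowPoly u 1).eval (t j) = u.1.det * (t j - t i) := by
    intro i j
    rw [hl, hl, hl, hl, Matrix.det_fin_two]; ring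
  simp only [h3, Finset.prod_mul_distrib, Finset.prod_const] at h2
  rw [← Matrix.det_vandermonde, mul_comm] at h2
  rw [mul_right_cancel₀ (Matrix.det_vandermonde_ne_zero_iff.2 ht) h2, Finset.prod_pow_eq_pow_sum]
  congr 1
  simp only [Fin.card_Ioi]
  rw [Fin.sum_univ_eq_sum_range (fun i => g - 1 - i) g, Finset.sum_range_reflect (fun i => i) g,
    Finset.sum_range_id]

/-- The determinant of `Sym^(g-1) u`. The field is enlarged so that there are enough points to
evaluate polynomials of degree less than `g`. -/
theorem det_symMatrix (u : GL (Fin 2) K) :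
    (symMatrix K g u).det = u.1.det ^ (g * (g - 1) / 2) := by
  let φ := algebraMap K (AlgebraicClosure K)
  let v : GL (Fin 2) (AlgebraicClosure K) := Matrix.GeneralLinearGroup.map φ u
  have hrow (j : Fin 2) : rowPoly v j = (rowPoly u j).map φ := by
    simp [rowPoly, v]
  have h1 : symMatrix (AlgebraicClosure K) g v = (symMatrix K g u).map φ := by
    ext i j
    simp only [symMatrix, Matrix.map_apply, Matrix.of_apply, hrow, ← Polynomial.map_pow,
      ← Polynomial.map_mul, coeff_map]
  have h2 := det_symMatrix_of_infinite (g := g) v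
  have h3 : v.1.det = φ u.1.det := by
    rw [RingHom.map_det]; rfl
  rw [h1, h3, ← map_pow] at h2
  apply φ.injective
  rw [← h2, RingHom.map_det]; rfl

end PullbackMonomial

/-! ### The Hodge line and its powers -/

section Lines
variable {R : Type*} [CommRing R]

theorem alternatingMap_eq_det_smul {M N ι : Type*} [AddCommGroup M] [Module R M] [AddCommGroup N]
    [Module R N] [Fintype ι] [DecidableEq ι] (b : Module.Basis ι R M) (f : M [⋀^ι]→ₗ[R] N)
    (v : ι → M) : f v = b.det v • f b := by
  have : f = (LinearMap.toSpanSingleton R N (f b)).compAlternatingMap b.det := by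
    refine Module.Basis.ext_alternating b fun i hi => ?_
    let σ : Equiv.Perm ι := Equiv.ofBijective i (Finite.injective_iff_bijective.1 hi)
    have h (h : M [⋀^ι]→ₗ[R] N) : h (fun j => b (i j)) = Equiv.Perm.sign σ • h b :=
      h.map_perm b σ
    rw [h, h]
    simp [Module.Basis.det_self]
  conv_lhs => rw [this]
  rfl

theorem exteriorPower_generator {M : Type*} [AddCommGroup M] [Module R M] {n : ℕ}
    (b : Module.Basis (Fin n) R M) :
    Function.Bijective (fun r : R => r • exteriorPower.ιMulti R n (b : Fin n → M)) := by
  constructor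
  · intro r s h
    have := congrArg (exteriorPower.alternatingMapLinearEquiv b.det) h
    simpa [exteriorPower.alternatingMapLinearEquiv_apply_ιMulti, Module.Basis.det_self] using this
  · intro m
    have hm : m ∈ Submodule.span R (Set.range (exteriorPower.ιMulti R n (M := M))) := by
      rw [exteriorPower.ιMulti_span]; trivial
    refine Submodule.mem_span_singleton.1 (Submodule.span_le.2 ?_ hm)
    rintro _ ⟨v, rfl⟩
    exact Submodule.mem_span_singleton.2 ⟨_, (alternatingMap_eq_det_smul b _ v).symm⟩

theorem tensorPower_generator {L : Type*} [AddCommGroup L] [Module R L] {ω : L}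
    (hω : Function.Bijective (fun r : R => r • ω)) (h : ℕ) :
    Function.Bijective (fun r : R => r • PiTensorProduct.tprod R fun _ : Fin h => ω) := by
  let e : R ≃ₗ[R] L := LinearEquiv.ofBijective (LinearMap.toSpanSingleton R L ω) hω
  have he : e.symm ω = 1 := by
    rw [LinearEquiv.symm_apply_eq]
    exact (one_smul R ω).symm
  constructor
  · intro r s hrs
    have := congrArg (PiTensorProduct.lift
      ((MultilinearMap.mkPiAlgebra R (Fin h) R).compLinearMap fun _ => e.symm.toLinearMap)) hrs
    simpa [he] using this
  · intro m
    have hm : m ∈ Submodule.span R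
        (Set.range (PiTensorProduct.tprod R (s := fun _ : Fin h => L))) := by
      rw [PiTensorProduct.span_tprod_eq_top]; trivial
    refine Submodule.mem_span_singleton.1 (Submodule.span_le.2 ?_ hm)
    rintro _ ⟨v, rfl⟩
    choose c hc using fun i => hω.2 (v i)
    obtain rfl : (fun i => c i • ω) = v := funext hc
    exact Submodule.mem_span_singleton.2 ⟨∏ i, c i, (MultilinearMap.map_smul_univ _ _ _).symm⟩

end Lines

section Sections
variable {R : Type u} [CommRing R] {g : ℕ} {F : BinaryForm R (2 * g + 2)}

theorem wedge_generator (hg : 1 ≤ g) (h2 : IsUnit (2 : R)) (hF : IsUnit F.disc)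
    {ω : Fin g → globalDifferentials F} (hω : ∀ i : Fin g, IsMonomial F i (ω i)) :
    Function.Bijective (fun r : R => r • HodgeLine.wedge ω) := by
  obtain ⟨b, rfl⟩ := IsMonomial.exists_basis hg h2 hF hω
  exact exteriorPower_generator b

theorem tpow_generator {ω : HodgeLine F} (hω : Function.Bijective (fun r : R => r • ω)) (h : ℕ) :
    Function.Bijective (fun r : R => r • ω.tpow h) :=
  tensorPower_generator hω h

theorem tpow_smul (c : R) (ω : HodgeLine F) (h : ℕ) : (c • ω).tpow h = c ^ h • ω.tpow h := by
  have := (PiTensorProduct.tprod R (s := fun _ : Fin h => HodgeLine F)).map_smul_univ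
    (fun _ => c) (fun _ => ω)
  rw [Finset.prod_const, Finset.card_univ, Fintype.card_fin] at this
  exact this

/-- The pullback `φ_u^*` multiplies the generator `ω` of the Hodge line by `det(u)^{dg/4}`: the
exponent is `g` from the factor `det u` of each differential, plus `g(g-1)/2` from `Sym^(g-1) u`. -/
theorem pullback_wedge {K : Type u} [Field K] (hg : 1 ≤ g) (h2 : (2 : K) ≠ 0)
    {F F' : BinaryForm K (2 * g + 2)} (hd : F.disc ≠ 0) (u : GL (Fin 2) K) (hF : F' = F.act u)
    {ω : Fin g → globalDifferentials F} (hω : ∀ i : Fin g, IsMonomial F i (ω i))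
    {ω' : Fin g → globalDifferentials F'} (hω' : ∀ i : Fin g, IsMonomial F' i (ω' i)) :
    HodgeLine.pullback u F F' hF (HodgeLine.wedge ω') =
      u.1.det ^ ((2 * g + 2) * g / 4) • HodgeLine.wedge ω := by
  obtain ⟨b, hb⟩ := IsMonomial.exists_basis hg h2.isUnit hd.isUnit hω
  have h1 : HodgeLine.pullback u F F' hF (HodgeLine.wedge ω') =
      HodgeLine.wedge (fun i => pullbackAct u F F' hF (ω' i)) :=
    exteriorPower.map_apply_ιMulti _ _
  have h3 : (fun i => pullbackAct u F F' hF (ω' i)) =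
      fun i => ∑ j, (u.1.det • symMatrix K g u) i j • b j :=
    funext fun i => by rw [pullbackAct_monomial hg h2 hd u hF hω hω' i, hb]
  have h4 : b.det (fun i => ∑ j, (u.1.det • symMatrix K g u) i j • b j) =
      u.1.det ^ ((2 * g + 2) * g / 4) := by
    have e : b.toMatrix (fun i => ∑ j, (u.1.det • symMatrix K g u) i j • b j) =
        (u.1.det • symMatrix K g u).transpose := by
      ext i j
      rw [Module.Basis.toMatrix_apply, Module.Basis.repr_sum_self, Matrix.transpose_apply]
    rw [Module.Basis.det_apply, e, Matrix.det_transpose, Matrix.det_smul, det_symMatrix,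
      Fintype.card_fin, ← pow_add]
    congr 1
    obtain ⟨m, hm⟩ : 2 ∣ g * (g - 1) := by
      rw [mul_comm]
      have := Nat.even_mul_succ_self (g - 1)
      rw [Nat.sub_add_cancel hg] at this
      exact this.two_dvd
    rw [hm, Nat.mul_div_cancel_left _ two_pos]
    have e2 : (2 * g + 2) * g = 4 * (g + m) := by
      obtain ⟨n, rfl⟩ : ∃ n, g = n + 1 := ⟨g - 1, by omega⟩
      rw [Nat.add_sub_cancel] at hm
      linarith
    rw [e2, Nat.mul_div_cancel_left _ (by norm_num)]
  have h5 := alternatingMap_eq_det_smul b (exteriorPower.ιMulti K g)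
    (fun i => ∑ j, (u.1.det • symMatrix K g u) i j • b j)
  rw [h1, h3, ← hb, ← h4]
  exact h5

theorem IsMonomial.baseChange {S : Type u} [CommRing S] (f : R →+* S)
    (F' : BinaryForm S (2 * g + 2)) (hF : ∀ i, f (F i) = F' i) {i : ℕ} {ω : globalDifferentials F}
    (hω : IsMonomial F i ω) :
    IsMonomial F' i (HyperellipticHodge.baseChange f F F' hF ω) := by
  have := congrArg (kaehlerMap f (chartBaseChange f F F' hF)
    (chartBaseChange_algebraMap f F F' hF)) hω
  rw [map_smulₛₗ, map_smulₛₗ, kaehlerMap_D, map_pow, chartBaseChange_X, chartBaseChange_Y] at this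
  exact this

end Sections

section Fibres
variable {k : Type u} [Field k] {g : ℕ} {K : Type u} [Field K] [Algebra k K]

theorem isUnit_disc_universalForm : IsUnit (universalForm k g).disc := by
  have h : algebraMap _ (BaseRing k g) (universalDisc k g) = (universalForm k g).disc :=
    disc_map (algebraMap (MvPolynomial (Fin (2 * g + 2 + 1)) k) (BaseRing k g)) _ _ fun _ => rfl
  rw [← h]
  exact IsLocalization.Away.algebraMap_isUnit _

theorem isUnit_two_baseRing (hk : (2 : k) ≠ 0) : IsUnit (2 : BaseRing k g) := by
  have := hk.isUnit.map (algebraMap k (BaseRing k g))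
  rwa [map_ofNat] at this

/-- The values at `F` of a family of differentials on the universal curve. -/
def monomialAt (ω : Fin g → globalDifferentials (universalForm k g)) (F : NonsingularForm K g) :
    Fin g → globalDifferentials F.1 := fun i =>
  baseChange _ (universalForm k g) F.1 (evalAt_universalForm (k := k) F) (ω i)

theorem at_wedge (ω : Fin g → globalDifferentials (universalForm k g)) (F : NonsingularForm K g) :
    HodgeLine.at k F (HodgeLine.wedge ω) = HodgeLine.wedge (monomialAt ω F) :=
  extMap_ιMulti _ _ _

theorem isMonomial_monomialAt {ω : Fin g → globalDifferentials (universalForm k g)}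
    (hω : ∀ i : Fin g, IsMonomial (universalForm k g) i (ω i)) (F : NonsingularForm K g)
    (i : Fin g) : IsMonomial F.1 i (monomialAt ω F i) :=
  (hω i).baseChange _ _ _

theorem at_tpow (ω : HodgeLine (universalForm k g)) (h : ℕ) (F : NonsingularForm K g) :
    HodgePower.at k h F (ω.tpow h) = (HodgeLine.at k F ω).tpow h :=
  tensorMap_tprod _ _ _

theorem pullback_tpow {F F' : BinaryForm K (2 * g + 2)} (u : GL (Fin 2) K) (hF : F' = F.act u)
    (h : ℕ) (ω : HodgeLine F') :
    HodgePower.pullback h u F F' hF (ω.tpow h) = (HodgeLine.pullback u F F' hF ω).tpow h :=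
  PiTensorProduct.map_tprod _ _

theorem two_ne_zero_of_algebra (hk : (2 : k) ≠ 0) : (2 : K) ≠ 0 := by
  rw [← map_ofNat (algebraMap k K) 2]
  exact (_root_.map_ne_zero _).2 hk

/-- The invariance of `Φ ω^{⊗h}` amounts to a transformation law for `Φ`. -/
theorem smul_tpow_mem_invariantSections_iff (hk : (2 : k) ≠ 0) (hg : 1 ≤ g)
    {ω : Fin g → globalDifferentials (universalForm k g)}
    (hω : ∀ i : Fin g, IsMonomial (universalForm k g) i (ω i)) (h : ℕ) (Φ : BaseRing k g) :
    Φ • (HodgeLine.wedge ω).tpow h ∈ invariantSections k g h ↔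
      ∀ (K : Type u) [Field K] [Algebra k K] (F F' : NonsingularForm K g) (u : GL (Fin 2) K),
        F'.1 = F.1.act u →
          evalAt F' Φ * u.1.det ^ ((2 * g + 2) * g / 4 * h) = evalAt F Φ := by
  have key (K : Type u) [Field K] [Algebra k K] (F F' : NonsingularForm K g) (u : GL (Fin 2) K)
      (hF : F'.1 = F.1.act u) :
      HodgePower.pullback h u F.1 F'.1 hF (HodgePower.at k h F' (Φ • (HodgeLine.wedge ω).tpow h)) =
        HodgePower.at k h F (Φ • (HodgeLine.wedge ω).tpow h) ↔
      evalAt F' Φ * u.1.det ^ ((2 * g + 2) * g / 4 * h) = evalAt F Φ := by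
    have h2 := two_ne_zero_of_algebra (K := K) hk
    have e (F : NonsingularForm K g) : HodgePower.at k h F (Φ • (HodgeLine.wedge ω).tpow h) =
        evalAt F Φ • (HodgeLine.wedge (monomialAt ω F)).tpow h := by
      refine ((HodgePower.at k h F).map_smulₛₗ Φ _).trans ?_
      rw [at_tpow, at_wedge]; rfl
    rw [e, e, map_smul, pullback_tpow, pullback_wedge hg h2 F.2 u hF (isMonomial_monomialAt hω F)
      (isMonomial_monomialAt hω F'), tpow_smul, ← pow_mul, ← mul_smul]
    exact (tpow_generator (wedge_generator hg h2.isUnit F.2.isUnit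
      (isMonomial_monomialAt hω F)) h).1.eq_iff
  exact ⟨fun H K _ _ F F' u hF => (key K F F' u hF).1 (H K F F' u hF),
    fun H K _ _ F F' u hF => (key K F F' u hF).2 (H K F F' u hF)⟩

end Fibres

/-! ### Scalars, points and invariants -/

section ActLemmas
variable {K : Type u} [Field K] {d : ℕ}

theorem act_of_inv_smul {u v : GL (Fin 2) K} {c : K} (h : ∀ i j, u⁻¹.1 i j = c * v⁻¹.1 i j)
    (F : BinaryForm K d) : F.act u = c ^ d • F.act v := by
  funext i
  have e (j : Fin 2) : (C (u⁻¹.1 j 0) * X + C (u⁻¹.1 j 1) : K[X]) =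
      C c * (C (v⁻¹.1 j 0) * X + C (v⁻¹.1 j 1)) := by
    rw [h, h, map_mul, map_mul]; ring
  rw [Pi.smul_apply, smul_eq_mul, BinaryForm.act, BinaryForm.act, e, e, BinaryForm.eval_mul,
    ← map_pow, coeff_C_mul]

theorem act_one (F : BinaryForm K d) : F.act 1 = F := by
  funext i
  rw [BinaryForm.act, ← coeff_eval_X_one F i]
  simp

theorem act_smul (u : GL (Fin 2) K) (c : K) (F : BinaryForm K d) :
    (c • F).act u = c • F.act u := by
  funext i
  rw [Pi.smul_apply, smul_eq_mul, BinaryForm.act, BinaryForm.act, ← coeff_C_mul]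
  congr 1
  simp only [BinaryForm.eval, Finset.mul_sum, Pi.smul_apply, smul_eq_mul, map_mul]
  exact Finset.sum_congr rfl fun i _ => by rw [← C_eq_algebraMap]; ring

/-- The scalar matrix `c`. -/
def scalarGL (c : Kˣ) : GL (Fin 2) K :=
  Units.map (Matrix.scalar (Fin 2) : K →+* Matrix (Fin 2) (Fin 2) K) c

theorem det_scalarGL (c : Kˣ) : (scalarGL c).1.det = (c : K) ^ 2 := by
  simp [scalarGL]

theorem scalarGL_inv_apply (c : Kˣ) (i j : Fin 2) :
    (scalarGL c)⁻¹.1 i j = (c : K)⁻¹ * (1 : Matrix (Fin 2) (Fin 2) K) i j := by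
  have : (scalarGL c)⁻¹.1 = Matrix.scalar (Fin 2) (c : K)⁻¹ := by
    rw [scalarGL, ← map_inv]; simp
  rw [this, Matrix.scalar_apply, Matrix.diagonal_apply, Matrix.one_apply]
  simp

theorem act_scalarGL (c : Kˣ) (F : BinaryForm K d) :
    F.act (scalarGL c) = (c : K)⁻¹ ^ d • F := by
  rw [act_of_inv_smul (v := 1) (c := (c : K)⁻¹)
    (fun i j => by rw [scalarGL_inv_apply, inv_one]; rfl), act_one]

/-- A matrix is the product of a scalar and a matrix of determinant one once its determinant is a
square. -/
theorem exists_det_one_act (u : GL (Fin 2) K) (c : Kˣ) (hc : (c : K) ^ 2 = u.1.det) :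
    ∃ v : GL (Fin 2) K, v.1.det = 1 ∧
      ∀ F : BinaryForm K d, F.act u = ((c : K)⁻¹ ^ d • F).act v := by
  refine ⟨(scalarGL c)⁻¹ * u, ?_, fun F => ?_⟩
  · have h : (scalarGL c)⁻¹ = scalarGL c⁻¹ := by rw [scalarGL, scalarGL, map_inv]
    rw [Units.val_mul, Matrix.det_mul, h, det_scalarGL, ← hc, ← mul_pow]
    simp
  · rw [act_smul]
    refine act_of_inv_smul (fun i j => ?_) F
    rw [mul_inv_rev, inv_inv, Units.val_mul]
    have : (scalarGL c).1 = Matrix.diagonal fun _ => (c : K) := rfl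
    rw [this, Matrix.mul_diagonal, mul_comm, mul_inv_cancel_right₀ c.ne_zero]

theorem map_act {L : Type u} [Field L] (φ : K →+* L) (u : GL (Fin 2) K) (F : BinaryForm K d) (i) :
    φ (F.act u i) = BinaryForm.act (Matrix.GeneralLinearGroup.map φ u) (fun i => φ (F i)) i := by
  have h := congrArg (coeff · (i : ℕ)) (eval_map φ F (fun i => φ (F i)) (fun _ => rfl)
    (C (u⁻¹.1 0 0) * X + C (u⁻¹.1 0 1)) (C (u⁻¹.1 1 0) * X + C (u⁻¹.1 1 1)))
  have e : (Matrix.GeneralLinearGroup.map φ u)⁻¹.1 = u⁻¹.1.map φ := by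
    rw [← map_inv]; rfl
  simp only [coe_mapRingHom, coeff_map, Polynomial.map_add, Polynomial.map_mul, map_C, map_X] at h
  rw [BinaryForm.act, BinaryForm.act, e]
  exact h

end ActLemmas

section Points
variable {k : Type u} [Field k] {g : ℕ} {K : Type u} [Field K] [Algebra k K]

/-- Multiplication of a nonsingular form by a nonzero scalar. -/
def NonsingularForm.smul (c : K) (hc : c ≠ 0) (F : NonsingularForm K g) : NonsingularForm K g :=
  ⟨c • F.1, by rw [disc_smul (by omega)]; exact mul_ne_zero (pow_ne_zero _ hc) F.2⟩

/-- The extension of a nonsingular form to a larger field. -/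
def NonsingularForm.extend (F : NonsingularForm K g) (L : Type u) [Field L] [Algebra K L] :
    NonsingularForm L g :=
  ⟨fun i => algebraMap K L (F.1 i), by
    rw [← disc_map (algebraMap K L) F.1 _ fun _ => rfl]
    exact (_root_.map_ne_zero _).2 F.2⟩

theorem evalAt_extend (F : NonsingularForm K g) (L : Type u) [Field L] [Algebra K L] [Algebra k L]
    [IsScalarTower k K L] (Φ : BaseRing k g) :
    evalAt (F.extend L) Φ = algebraMap K L (evalAt F Φ) := by
  have : (evalAt (F.extend L) : BaseRing k g →ₐ[k] L) =
      (IsScalarTower.toAlgHom k K L).comp (evalAt F) := by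
    refine IsLocalization.algHom_ext (Submonoid.powers (universalDisc k g)) ?_
    refine MvPolynomial.algHom_ext fun i => ?_
    have h1 := evalAt_universalForm (k := k) (F.extend L) i
    have h2 := evalAt_universalForm (k := k) F i
    exact h1.trans (congrArg (algebraMap K L) h2).symm
  exact congrArg (fun φ : BaseRing k g →ₐ[k] L => φ Φ) this

theorem extend_act {F F' : NonsingularForm K g} {u : GL (Fin 2) K} (hF : F'.1 = F.1.act u)
    (L : Type u) [Field L] [Algebra K L] : (F'.extend L).1 =
      (F.extend L).1.act (Matrix.GeneralLinearGroup.map (algebraMap K L) u) := by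
  funext i
  change algebraMap K L (F'.1 i) = _
  rw [hF, map_act]
  rfl

theorem isReduced_baseRing : IsReduced (BaseRing k g) :=
  isReduced_localizationPreserves (Submonoid.powers (universalDisc k g)) _ inferInstance

/-- A regular function on the space of nonsingular forms which vanishes at all points over all
extension fields is zero: it lies in all prime ideals, as is seen at the points of the space
itself. -/
theorem eq_zero_of_evalAt {Φ : BaseRing k g}
    (h : ∀ (K : Type u) [Field K] [Algebra k K] (F : NonsingularForm K g), evalAt F Φ = 0) :
    Φ = 0 := by
  have := isReduced_baseRing (k := k) (g := g)
  rw [← Ideal.mem_bot, ← Ideal.zero_eq_bot, ← nilradical_eq_zero (BaseRing k g), nilradical,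
    Ideal.radical_eq_sInf, Ideal.mem_sInf]
  rintro P ⟨-, hP⟩
  let L := P.ResidueField
  let F : NonsingularForm L g := ⟨fun i => algebraMap (BaseRing k g) L (universalForm k g i), by
    rw [← disc_map (algebraMap (BaseRing k g) L) (universalForm k g) _ fun _ => rfl]
    exact (isUnit_disc_universalForm.map _).ne_zero⟩
  have e : (evalAt F : BaseRing k g →ₐ[k] L) = IsScalarTower.toAlgHom k (BaseRing k g) L := by
    refine IsLocalization.algHom_ext (Submonoid.powers (universalDisc k g)) ?_
    exact MvPolynomial.algHom_ext fun i => evalAt_universalForm (k := k) F i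
  have h1 := h L F
  rw [e] at h1
  exact Ideal.algebraMap_residueField_eq_zero.1 h1

/-- An invariant of degree `w` is multiplied by a power of the determinant under `GL₂`: over an
algebraically closed field a matrix is the product of a scalar `λ` and a matrix of determinant one,
and `λ` multiplies forms by `λ⁻ᵈ`. -/
theorem evalAt_act_of_mem_invariants {w n : ℕ} (hn : 2 * n = (2 * g + 2) * w) {Φ : BaseRing k g}
    (hΦ : Φ ∈ invariants k g w) (F F' : NonsingularForm K g) (u : GL (Fin 2) K)
    (hF : F'.1 = F.1.act u) : evalAt F' Φ * u.1.det ^ n = evalAt F Φ := by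
  let L := AlgebraicClosure K
  apply (algebraMap K L).injective
  let v := Matrix.GeneralLinearGroup.map (algebraMap K L) u
  have hv : v.1.det = algebraMap K L u.1.det := by rw [RingHom.map_det]; rfl
  have hv0 : v.1.det ≠ 0 := ((Matrix.isUnit_iff_isUnit_det v.1).1 v.isUnit).ne_zero
  obtain ⟨c, hc⟩ := IsAlgClosed.exists_pow_nat_eq v.1.det two_pos
  have hc0 : c ≠ 0 := fun h => hv0 (by rw [← hc, h]; simp)
  rw [map_mul, map_pow, ← evalAt_extend, ← evalAt_extend, ← hv]
  obtain ⟨v', hv', hact⟩ := exists_det_one_act (d := 2 * g + 2) v (Units.mk0 c hc0) hc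
  have hE := extend_act hF L
  rw [hact] at hE
  have hne : (c⁻¹ ^ (2 * g + 2) : L) ≠ 0 := pow_ne_zero _ (inv_ne_zero hc0)
  rw [(hΦ L ((F.extend L).smul _ hne) (F'.extend L)).2 v' hv' hE,
    (hΦ L (F.extend L) ((F.extend L).smul _ hne)).1 _ hne rfl, ← hc, ← pow_mul, ← pow_mul, hn,
    mul_right_comm, ← mul_pow, inv_mul_cancel₀ hc0, one_pow, one_mul]

/-- A function with the transformation law of `evalAt_act_of_mem_invariants` is an invariant. -/
theorem mem_invariants_of_evalAt_act {w n : ℕ} (hn : 2 * n = (2 * g + 2) * w) {Φ : BaseRing k g}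
    (hΦ : ∀ (K : Type u) [Field K] [Algebra k K] (F F' : NonsingularForm K g) (u : GL (Fin 2) K),
      F'.1 = F.1.act u → evalAt F' Φ * u.1.det ^ n = evalAt F Φ) : Φ ∈ invariants k g w := by
  refine fun K _ _ F F' => ⟨fun c hc hF => ?_, fun u hu hF => ?_⟩
  · let L := AlgebraicClosure K
    apply (algebraMap K L).injective
    have hc' : algebraMap K L c ≠ 0 := (_root_.map_ne_zero _).2 hc
    obtain ⟨a, ha⟩ := IsAlgClosed.exists_pow_nat_eq (algebraMap K L c) (n := 2 * g + 2) (by omega)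
    have ha0 : a ≠ 0 := fun h => hc' (by rw [← ha, h]; simp)
    have hE : (F'.extend L).1 = (F.extend L).1.act (scalarGL (Units.mk0 a ha0)⁻¹) := by
      rw [act_scalarGL]
      funext i
      change algebraMap K L (F'.1 i) = _
      rw [hF, Pi.smul_apply, smul_eq_mul, map_mul, ← ha, Units.val_inv_eq_inv_val, inv_inv]
      rfl
    have h1 := hΦ L (F.extend L) (F'.extend L) _ hE
    rw [det_scalarGL, Units.val_inv_eq_inv_val, Units.val_mk0, ← pow_mul, hn] at h1
    rw [map_mul, map_pow, ← evalAt_extend, ← evalAt_extend, ← h1, ← ha, ← pow_mul, mul_left_comm,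
      ← mul_pow, mul_inv_cancel₀ ha0, one_pow, mul_one]
  · have h1 := hΦ K F F' u hF
    rwa [hu, one_pow, mul_one] at h1

/-- There are no invariants of half-integral degree: a scalar `λ` with `λ^(d/2) = -1` fixes all
forms but changes the sign of `Φ`. -/
theorem eq_zero_of_odd (hk : (2 : k) ≠ 0) {e n : ℕ} (he : Odd e) (hn : 2 * n = (g + 1) * e)
    {Φ : BaseRing k g}
    (hΦ : ∀ (K : Type u) [Field K] [Algebra k K] (F F' : NonsingularForm K g) (u : GL (Fin 2) K),
      F'.1 = F.1.act u → evalAt F' Φ * u.1.det ^ n = evalAt F Φ) : Φ = 0 := by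
  refine eq_zero_of_evalAt fun K _ _ F => ?_
  let L := AlgebraicClosure K
  apply (algebraMap K L).injective
  obtain ⟨a, ha⟩ := IsAlgClosed.exists_pow_nat_eq (-1 : L) (n := g + 1) (by omega)
  have ha0 : a ≠ 0 := fun h => by simp [h] at ha
  have hE : (F.extend L).1 = (F.extend L).1.act (scalarGL (Units.mk0 a ha0)) := by
    have : a ^ (2 * g + 2) = 1 := by
      rw [show 2 * g + 2 = (g + 1) * 2 by ring, pow_mul, ha]; simp
    rw [act_scalarGL, Units.val_mk0, inv_pow, this, inv_one, one_smul]
  have h1 := hΦ L (F.extend L) (F.extend L) _ hE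
  rw [det_scalarGL, Units.val_mk0, ← pow_mul, hn, pow_mul, ha, he.neg_one_pow] at h1
  have h2 : (2 : L) ≠ 0 := two_ne_zero_of_algebra hk
  rw [← evalAt_extend, map_zero]
  apply (mul_eq_zero.1 (?_ : 2 * evalAt (F.extend L) Φ = 0)).resolve_left h2
  linear_combination -h1

end Points

end
end HyperellipticHodge

theorem proposition3p4 {k : Type u} [Field k] (hk : (2 : k) ≠ 0) (d g : ℕ) (hd : 6 ≤ d)
    (hdg : d = 2 * g + 2) :
    -- the differentials `ω_{i+1} = x^i dx / y`, `0 ≤ i < g`, exist and are unique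
    (∃! ω : Fin g → globalDifferentials (universalForm k g),
      ∀ i : Fin g, IsMonomialDifferential k g i (ω i)) ∧
    ∀ ωs : Fin g → globalDifferentials (universalForm k g),
      (∀ i : Fin g, IsMonomialDifferential k g i (ωs i)) →
      ∀ ω : HodgeLine (universalForm k g), ω = HodgeLine.wedge ωs →
      -- `φ_u^* ω = det(u)^{dg/4} ω`
      (4 ∣ d * g ∧ ∀ (K : Type u) [Field K] [Algebra k K] (F F' : NonsingularForm K g)
        (u : GL (Fin 2) K) (hF : F'.1 = F.1.act u),
        HodgeLine.pullback u F.1 F'.1 hF (HodgeLine.at k F' ω) =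
          u.1.det ^ (d * g / 4) • HodgeLine.at k F ω) ∧
      -- `Φ ↦ Φ · ω^{⊗h}` is an isomorphism
      (∀ h : ℕ,
        (∀ w : ℕ, 2 * w = g * h → ∃ τ : invariants k g w ≃ₗ[k] invariantSections k g h,
          ∀ Φ : invariants k g w, (τ Φ : HodgePower (universalForm k g) h) =
            (Φ : BaseRing k g) • ω.tpow h) ∧
        (Odd (g * h) → invariantSections k g h = ⊥)) := by
  subst hdg
  have hg : 1 ≤ g := by omega
  have h2 : IsUnit (2 : BaseRing k g) := isUnit_two_baseRing hk
  have hdisc : IsUnit (universalForm k g).disc := isUnit_disc_universalForm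
  refine ⟨?_, fun ωs hωs ω hω => ?_⟩
  · choose ω hω hu using fun i : Fin g => existsUnique_isMonomial hg h2 hdisc i.2
    exact ⟨ω, hω, fun θ hθ => funext fun i => hu i _ (hθ i)⟩
  subst hω
  have h4 : 4 ∣ (2 * g + 2) * g := by
    obtain ⟨m, hm⟩ := (Nat.even_mul_succ_self g).two_dvd
    exact ⟨m, by linarith⟩
  refine ⟨⟨h4, fun K _ _ F F' u hF => ?_⟩, fun h => ?_⟩
  · rw [at_wedge, at_wedge]
    exact pullback_wedge hg (two_ne_zero_of_algebra hk) F.2 u hF (isMonomial_monomialAt hωs F)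
      (isMonomial_monomialAt hωs F')
  have hgen := tpow_generator (wedge_generator hg h2 hdisc hωs) h
  have hiff := smul_tpow_mem_invariantSections_iff hk hg hωs h
  have hn : 4 * ((2 * g + 2) * g / 4 * h) = (2 * g + 2) * g * h := by
    rw [← mul_assoc, Nat.mul_div_cancel' h4]
  refine ⟨fun w hw => ?_, fun hodd => ?_⟩
  · have hn' : 2 * ((2 * g + 2) * g / 4 * h) = (2 * g + 2) * w := by
      have : (2 * g + 2) * g * h = 2 * ((2 * g + 2) * w) := by
        rw [mul_assoc, ← hw]; ring
      omega
    let τ : invariants k g w →ₗ[k] invariantSections k g h :=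
      LinearMap.codRestrict _
        { toFun := fun Φ => (Φ : BaseRing k g) • (HodgeLine.wedge ωs).tpow h
          map_add' := fun Φ Ψ => add_smul _ _ _
          map_smul' := fun c Φ => by
            rw [Submodule.coe_smul, Algebra.smul_def, mul_smul]; rfl }
        fun Φ => (hiff Φ).2 fun K _ _ => evalAt_act_of_mem_invariants hn' Φ.2
    refine ⟨LinearEquiv.ofBijective τ ⟨fun Φ Ψ hΦΨ => ?_, fun s => ?_⟩, fun Φ => rfl⟩
    · exact Subtype.ext (hgen.1 (congrArg Subtype.val hΦΨ))
    · obtain ⟨Φ, hΦ⟩ := hgen.2 s.1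
      have hs : Φ • (HodgeLine.wedge ωs).tpow h ∈ invariantSections k g h := by
        rw [show Φ • (HodgeLine.wedge ωs).tpow h = s.1 from hΦ]; exact s.2
      exact ⟨⟨Φ, mem_invariants_of_evalAt_act hn' ((hiff Φ).1 hs)⟩, Subtype.ext hΦ⟩
  · rw [Submodule.eq_bot_iff]
    intro s hs
    obtain ⟨Φ, rfl⟩ := hgen.2 s
    have hn' : 2 * ((2 * g + 2) * g / 4 * h) = (g + 1) * (g * h) := by
      have : (2 * g + 2) * g * h = 2 * ((g + 1) * (g * h)) := by ring
      omega
    have hΦ := eq_zero_of_odd hk hodd hn' ((hiff Φ).1 hs)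
    simp only [hΦ, zero_smul]
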